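/- For $1<\alpha\le 2$ and $|\beta|<1$ let $f(x;\alpha,\beta)$ be the (continuous) density of the stable law with characteristic function $$\Phi(t;\alpha,\beta)=\exp\Bigl(-|t|^{\alpha}\bigl\{1+i\beta(\operatorname{sgn}t)\tan\bigl(\tfrac{\pi\alpha}{2}\bigr)(|t|^{1-\alpha}-1)\bigr\}\Bigr),$$ that is, $f(x;\alpha,\beta)=\frac1{2\pi}\int_{-\infty}^{\infty}e^{-itx}\Phi(t;\alpha,\beta)\,dt$; let $f'(x;\alpha,\beta)$ be its derivative in $x$, and let $f(x;2)=\frac{1}{2\sqrt\pi}e^{-x^2/4}$ be the density of $N(0,2)$. Write $\Delta=2-\alpha$, $\zeta=-\beta\tan(\pi\alpha/2)$, $\beta^*=\beta\operatorname{sgn}(x-\zeta)$, and for $x\ne\zeta$ $$F_1'(x;\alpha,\beta)=-\frac{x-\zeta}{2}f(x-\zeta;2),\qquad F_2'(x;\alpha,\beta)=-3(1+\beta^*)\Delta\,\operatorname{sgn}(x-\zeta)\,|x-\zeta|^{\Delta-4},$$ $$g'(x;\alpha,\beta)=F_1'(x;\alpha,\beta)+F_2'(x;\alpha,\beta)$$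 (so $F_2'=-3(1+\beta^*)\Delta(x-\zeta)^{\Delta-4}$ when $x>\zeta$). Let $\beta\in(-1,1)$ be fixed. (i) For every $\epsilon>0$ there exist $\Delta_0>0$ and $x_0>0$ such that for all $0\le\Delta<\Delta_0$ and all $|x|>x_0$ the function $f(\cdot\,;\alpha,\beta)$ is differentiable at $x$, $g'(x;\alpha,\beta)\ne0$, and $$\left|\frac{f'(x;\alpha,\beta)}{g'(x;\alpha,\beta)}-1\right|<\epsilon .$$ (ii) For every $\delta>0$ and every $x_0>0$, as $\Delta\downarrow0$, $$g'(x;\alpha,\beta)=\begin{cases}F_1'(x;\alpha,\beta)\,(1+o(\Delta^{\delta/2})) & \text{if } |x-\zeta|\le(2-\delta)(\log 1/\Delta)^{1/2},\\ F_2'(x;\alpha,\beta)\,(1+o(\Delta^{\delta/2})) & \text{if } |x-\zeta|\ge(2+\delta)(\log 1/\Delta)^{1/2},\end{cases}$$ uniformly in $|x|>x_0$; that is, for every $\eta>0$ there is $\Delta_1>0$ such that for all $0<\Delta<\Delta_1$ and all $|x|>x_0$, $|g'-F_1'|\le\eta\,\Delta^{\delta/2}|F_1'|$ in the first range and $|g'-F_2'|\le\eta\,\Delta^{\delta/2}|F_2'|$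 in the second. -/

import Mathlib

open Complex in
/-- Characteristic function `Φ(t; α, β)` of the standard (`μ = 0`, `σ = 1`) stable law in
Zolotarev's (M) parameterization. -/
noncomputable def stableCharFun (α β t : ℝ) : ℂ :=
  cexp (-((|t| ^ α : ℝ) : ℂ) *
    (1 + I * ((β * Real.sign t * Real.tan (Real.pi * α / 2) * (|t| ^ (1 - α) - 1) : ℝ) : ℂ)))

open Complex in
/-- The density `f(x; α, β)` of the stable law, i.e. the (continuous) density whose characteristic
function is `Φ(·; α, β)`, given by `(1 / 2π) ∫ e^{-itx} Φ(t; α, β) dt`. The integral is real because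
`Φ(-t; α, β)` is the complex conjugate of `Φ(t; α, β)`.
See `eq_stableDensity_of_charFun` below. -/
noncomputable def stableDensity (α β x : ℝ) : ℝ :=
  (1 / (2 * (Real.pi : ℂ)) * ∫ t : ℝ, cexp (-(I * t * x)) * stableCharFun α β t).re

/-- The density `f(x; 2)` of the normal distribution `N(0, 2)`. -/
noncomputable def normalDensity (x : ℝ) : ℝ :=
  1 / (2 * √Real.pi) * Real.exp (-(x ^ 2) / 4)

/-- The shift `ζ = -β tan(πα/2)`. -/
noncomputable def stableShift (α β : ℝ) : ℝ :=
  -β * Real.tan (Real.pi * α / 2)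

/-- The Gaussian part `-((x - ζ)/2) f(x - ζ; 2)`, i.e. the derivative of `f(x - ζ; 2)`. -/
noncomputable def gaussPart (α β x : ℝ) : ℝ :=
  -((x - stableShift α β) / 2) * normalDensity (x - stableShift α β)

/-- The power part: with `Δ = 2 - α` and `β* = β sgn(x - ζ)` it is
`-3 (1 + β*) Δ (x - ζ)^{Δ - 4}` for `x > ζ`, continued to `x < ζ` by the reflection rule
`f'(x; α, β) = -f'(-x; α, -β)`, i.e. as `-3 (1 + β*) Δ sgn(x - ζ) |x - ζ|^{Δ - 4}`. -/
noncomputable def powerPart (α β x : ℝ) : ℝ :=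
  -3 * (1 + β * Real.sign (x - stableShift α β)) * (2 - α) *
    (Real.sign (x - stableShift α β) * |x - stableShift α β| ^ ((2 - α) - 4))

/-- The approximant `g'(x; α, β)`. -/
noncomputable def derivApprox (α β x : ℝ) : ℝ :=
  gaussPart α β x + powerPart α β x

open MeasureTheory Real in
theorem integrable_exp_neg_abs_rpow {α : ℝ} (hα : 0 < α) :
    Integrable (fun t : ℝ => Real.exp (-|t| ^ α)) := by
  have h : IntegrableOn (fun t : ℝ => Real.exp (-|t| ^ α)) (Set.Ioi 0) := by
    have := integrableOn_rpow_mul_exp_neg_rpow (p := α) (s := 0) (by norm_num) hα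
    refine this.congr_fun (fun t ht => ?_) measurableSet_Ioi
    simp [abs_of_pos (Set.mem_Ioi.1 ht)]
  have h2 : IntegrableOn (fun t : ℝ => Real.exp (-|t| ^ α)) (Set.Iic 0) := by
    rw [integrableOn_Iic_iff_integrableOn_Iio]
    have := h.comp_neg
    simpa using this
  rw [← integrableOn_univ, ← Set.Iic_union_Ioi (a := (0 : ℝ))]
  exact h2.union h

theorem norm_stableCharFun (α β t : ℝ) :
    ‖stableCharFun α β t‖ = Real.exp (-|t| ^ α) := by
  rw [stableCharFun, Complex.norm_exp]
  congr 1
  simp only [Complex.mul_re, Complex.neg_re, Complex.neg_im, Complex.ofReal_re, Complex.ofReal_im,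
    Complex.add_re, Complex.one_re, Complex.I_re, Complex.I_im]
  ring

open MeasureTheory in
/-- `stableDensity α β` is the only possible continuous probability density with characteristic
function `stableCharFun α β`. -/
theorem eq_stableDensity_of_charFun {α : ℝ} (hα : 0 < α) (β : ℝ) (p : ℝ → ℝ)
    (hpc : Continuous p) (hp0 : ∀ x, 0 ≤ p x) (hpi : Integrable p)
    (hp : ∀ t, charFun (volume.withDensity (fun x => ENNReal.ofReal (p x))) t
      = stableCharFun α β t) :
    p = stableDensity α β := by
  have hm : Measurable (fun x => ENNReal.ofReal (p x)) := hpc.measurable.ennreal_ofReal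
  have hF : FourierTransform.fourier (fun x => (p x : ℂ))
      = fun w : ℝ => stableCharFun α β (-(2 * Real.pi) * w) := by
    ext w
    rw [← hp, charFun_apply_real, Real.fourier_real_eq_integral_exp_smul,
      integral_withDensity_eq_integral_toReal_smul hm (by simp)]
    refine integral_congr_ae (Filter.Eventually.of_forall fun x => ?_)
    simp only [ENNReal.toReal_ofReal (hp0 x), smul_eq_mul, Complex.real_smul]
    rw [mul_comm]
    congr 2
    push_cast
    ring
  have hcF : Continuous (FourierTransform.fourier (fun x => (p x : ℂ))) :=
    VectorFourier.fourierIntegral_continuous Real.continuous_fourierChar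
      (by fun_prop) hpi.ofReal
  have hiF : Integrable (FourierTransform.fourier (fun x => (p x : ℂ))) := by
    refine Integrable.mono' (((integrable_exp_neg_abs_rpow hα).comp_mul_left'
      (R := -(2 * Real.pi)) (by simp [Real.pi_ne_zero]))) hcF.aestronglyMeasurable ?_
    refine Filter.Eventually.of_forall fun w => ?_
    rw [hF]
    simp only [norm_stableCharFun]
    exact le_rfl
  have hinv := Continuous.fourierInv_fourier_eq (f := fun x => (p x : ℂ))
    (by fun_prop) hpi.ofReal hiF
  ext x
  have hx := congrFun hinv x
  rw [Real.fourierInv_eq', hF] at hx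
  have h2 : ∫ w : ℝ, Complex.exp (-(Complex.I * ((-(2 * Real.pi) * w : ℝ) : ℂ) * x)) *
      stableCharFun α β (-(2 * Real.pi) * w) = p x := by
    rw [← hx]
    refine integral_congr_ae (Filter.Eventually.of_forall fun w => ?_)
    simp only [smul_eq_mul]
    congr 2
    simp
    ring
  rw [Measure.integral_comp_mul_left (fun t : ℝ => Complex.exp (-(Complex.I * (t : ℂ) * x)) *
      stableCharFun α β t)] at h2
  rw [stableDensity]
  have h3 : |(-(2 * Real.pi))⁻¹| = 1 / (2 * Real.pi) := by
    rw [abs_inv, abs_neg, abs_of_pos (by positivity), one_div]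
  rw [h3, Complex.real_smul] at h2
  push_cast at h2
  rw [h2, Complex.ofReal_re]

/-!
Write `d = 2 - α`. Multiplying out the characteristic function turns the term `|t|^(1 - α) - 1` into
a shift by `ζ`, so that with `y = x - ζ` the derivative of the density is `1 / π` times the real
part of the integral over `t > 0` of
`E(t) = -i t exp (-i t y - (1 + i b τ) t^(2 - d))`, where `b = β` and `τ = tan (π d / 2)`
(`hasDerivAt_stableDensity_halfLine`). Changing the sign of `y` amounts to changing that of `b`, so
`y > 0` may be assumed.

The function `E` is analytic in the right half-plane. The contour is moved down the imaginary axis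
from `0` to the saddle point `-iy/2` of the Gaussian exponent and from there horizontally to
infinity (`integral_derivIntegrand_eq_contour`).

* On the imaginary axis the exponent at `-iu` has imaginary part `sin (π d / 2) (1 + b) u^(2 - d)`,
  and the integrand is damped by `exp (-u y)`. Rescaling `u = v / y` and dominated convergence give
  the power law `-3 (1 + b) d y^(d - 4)`, uniformly as `d → 0` and `y → ∞`
  (`tendsto_integral_axisIntegrand`).
* In the right half-plane, `(1 + i b τ) z^(2 - d)` is `‖z‖^(-d) z²` up to a relative error `5 d`
  (`exists_mul_cpow_eq`). If `d y⁴ ≤ 1`, then the exponent on the horizontal line converges to the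
  one for `d = 0`, and the integral is asymptotic to the derivative of the normal density
  (`tendsto_integral_shift`). If `d y⁴ ≥ 1`, then the power law is at least a constant times
  `y^(-8)`, and against it both the horizontal integral, which is of order `y³ exp (-y² / 8)`
  (`norm_integral_shift_le`), and the Gaussian term are negligible.

Both parts of the approximant have the sign of `-y`, so that they cannot cancel, and errors which
are small relative to one of them are small relative to the sum.

For the ranges of dominance put `L = log (1 / Δ)`. If `|y| ≤ (2 - δ) √L`, then
`exp (-y² / 4) ≥ Δ^((1 - δ/2)²)`, and `1 - (1 - δ/2)² > δ/2` because `0 < δ < 2`. If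
`|y| ≥ (2 + δ) √L`, then `exp (-y² / 4) ≤ Δ^((1 + δ/2)²)`, and `(1 + δ/2)² > 1 + δ/2`.
-/

/-! ### The integrand and its bounds in the right half-plane -/

/-- The analytic continuation to the right half-plane of the integrand of the Fourier integral for
`f'`, as a function of the complex frequency `z`. Here `d` stands for `2 - α` and `y` for the
distance `x - ζ` from the shift. -/
noncomputable def derivIntegrand (d b y : ℝ) (z : ℂ) : ℂ :=
  -(Complex.I * z) * Complex.exp (-(Complex.I * z * y) -
    (1 + Complex.I * ((b * Real.tan (Real.pi * d / 2) : ℝ) : ℂ)) * z ^ ((2 - d : ℝ) : ℂ))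

theorem tan_le_two_mul {x : ℝ} (h0 : 0 ≤ x) (h1 : x ≤ 1) : Real.tan x ≤ 2 * x := by
  have hc : 1 / 2 ≤ Real.cos x := by
    have := Real.one_sub_sq_div_two_le_cos (x := x)
    nlinarith
  rw [Real.tan_eq_sin_div_cos, div_le_iff₀ (by linarith)]
  have := Real.sin_le h0
  nlinarith

theorem tan_pi_mul_div_two_mem_Icc {d : ℝ} (h0 : 0 ≤ d) (h1 : d ≤ 1 / 10) :
    Real.tan (Real.pi * d / 2) ∈ Set.Icc 0 (Real.pi * d) := by
  have hp := Real.pi_pos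
  have hp4 := Real.pi_lt_four
  constructor
  · exact Real.tan_nonneg_of_nonneg_of_le_pi_div_two (by positivity) (by nlinarith)
  · have := tan_le_two_mul (x := Real.pi * d / 2) (by positivity) (by nlinarith)
    linarith

/-- In the closed right half-plane the exponent `(1 + i b tan(πd/2)) z^(2-d)` differs from
`‖z‖^(-d) z²` by a relative error of at most `5 d`. -/
theorem exists_mul_cpow_eq {d b : ℝ} (h0 : 0 ≤ d) (h1 : d ≤ 1 / 10) (hb : |b| ≤ 1) {z : ℂ}
    (hz : 0 ≤ z.re) (hz0 : z ≠ 0) :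
    ∃ e : ℂ, ‖e‖ ≤ 5 * d ∧
      (1 + Complex.I * ((b * Real.tan (Real.pi * d / 2) : ℝ) : ℂ)) * z ^ ((2 - d : ℝ) : ℂ) =
        ((‖z‖ ^ (-d) : ℝ) : ℂ) * z ^ 2 * (1 + e) := by
  obtain ⟨ht0, ht1⟩ := tan_pi_mul_div_two_mem_Icc h0 h1
  set τ := Real.tan (Real.pi * d / 2)
  -- `u` is the phase of `z ^ (-d)`
  set u : ℂ := Complex.exp (Complex.I * ((-(d * z.arg) : ℝ) : ℂ)) with hu
  have hu1 : ‖u‖ = 1 := by rw [hu, mul_comm]; exact Complex.norm_exp_ofReal_mul_I _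
  have harg : |z.arg| ≤ Real.pi / 2 := Complex.abs_arg_le_pi_div_two_iff.2 hz
  have hu2 : ‖u - 1‖ ≤ d * (Real.pi / 2) := by
    refine Real.norm_exp_I_mul_ofReal_sub_one_le.trans ?_
    rw [norm_neg, norm_mul, Real.norm_eq_abs, Real.norm_eq_abs, abs_of_nonneg h0]
    gcongr
  have hpow : z ^ ((2 - d : ℝ) : ℂ) = ((‖z‖ ^ (-d) : ℝ) : ℂ) * z ^ 2 * u := by
    have : ((2 - d : ℝ) : ℂ) = (2 : ℕ) + ((-d : ℝ) : ℂ) := by push_cast; ring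
    rw [this, Complex.cpow_add _ _ hz0, Complex.cpow_natCast, mul_comm ((_ : ℝ) : ℂ), mul_assoc]
    congr 1
    have hn : 0 < ‖z‖ := norm_pos_iff.2 hz0
    rw [Complex.cpow_def_of_ne_zero hz0, Real.rpow_def_of_pos hn, Complex.ofReal_exp, hu,
      ← Complex.exp_add, Complex.log]
    congr 1
    push_cast
    ring
  refine ⟨(u - 1) + Complex.I * ((b * τ : ℝ) : ℂ) * u, ?_, by rw [hpow]; ring⟩
  refine (norm_add_le _ _).trans ?_
  rw [norm_mul, norm_mul, Complex.norm_I, hu1, Complex.norm_real, Real.norm_eq_abs, abs_mul,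
    abs_of_nonneg ht0]
  have : |b| * τ ≤ 1 * (Real.pi * d) := by gcongr
  nlinarith [Real.pi_lt_d2]

/-- The loss in replacing `‖z‖^(-d)` by `1` falls on the negative terms in `s²` only, where it
has the right sign; no logarithm of `‖z‖` enters. -/
theorem re_mul_cpow_ge {d b : ℝ} (h0 : 0 ≤ d) (h1 : d ≤ 1 / 10) (hb : |b| ≤ 1) {r s : ℝ}
    (hr : 0 ≤ r) (hn : 1 ≤ ‖(r - Complex.I * s : ℂ)‖) :
    1 / 2 * ‖(r - Complex.I * s : ℂ)‖ ^ (-d) * r ^ 2 - (1 + 5 * d) * s ^ 2 ≤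
      ((1 + Complex.I * ((b * Real.tan (Real.pi * d / 2) : ℝ) : ℂ)) *
        (r - Complex.I * s : ℂ) ^ ((2 - d : ℝ) : ℂ)).re := by
  have hz0 : (r - Complex.I * s : ℂ) ≠ 0 := by
    intro h; rw [h] at hn; norm_num at hn
  obtain ⟨e, he, h⟩ := exists_mul_cpow_eq h0 h1 hb (z := r - Complex.I * s) (by simpa using hr) hz0
  rw [h]
  have hsq : ‖(r - Complex.I * s : ℂ)‖ ^ 2 = r ^ 2 + s ^ 2 := by
    rw [← Complex.normSq_eq_norm_sq, Complex.normSq_apply]; simp; ring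
  set ρ := ‖(r - Complex.I * s : ℂ)‖
  have hρ0 : 0 ≤ ρ ^ (-d) := by positivity
  have hρ1 : ρ ^ (-d) ≤ 1 := Real.rpow_le_one_of_one_le_of_nonpos hn (by linarith)
  have hre : -(5 * d * (r ^ 2 + s ^ 2)) ≤ ((r - Complex.I * s : ℂ) ^ 2 * e).re := by
    have h3 := Complex.abs_re_le_norm ((r - Complex.I * s : ℂ) ^ 2 * e)
    rw [norm_mul, norm_pow, hsq] at h3
    have h4 := neg_abs_le ((r - Complex.I * s : ℂ) ^ 2 * e).re
    have : (r ^ 2 + s ^ 2) * ‖e‖ ≤ (r ^ 2 + s ^ 2) * (5 * d) := by gcongr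
    linarith
  have h2 : ((r - Complex.I * s : ℂ) ^ 2).re = r ^ 2 - s ^ 2 := by
    rw [sq, Complex.mul_re]; simp; ring
  rw [mul_assoc ((_ : ℝ) : ℂ), Complex.re_ofReal_mul, mul_add, mul_one, Complex.add_re, h2]
  have h5 : ρ ^ (-d) * ((r ^ 2 - s ^ 2) - 5 * d * (r ^ 2 + s ^ 2)) ≤
      ρ ^ (-d) * (r ^ 2 - s ^ 2 + ((r - Complex.I * s : ℂ) ^ 2 * e).re) := by
    gcongr; linarith
  have h6 : ρ ^ (-d) * ((1 + 5 * d) * s ^ 2) ≤ 1 * ((1 + 5 * d) * s ^ 2) := by gcongr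
  have h7 : 0 ≤ ρ ^ (-d) * ((1 / 2 - 5 * d) * r ^ 2) := by
    have : 0 ≤ 1 / 2 - 5 * d := by linarith
    positivity
  nlinarith

theorem norm_derivIntegrand (d b y : ℝ) (r s : ℝ) :
    ‖derivIntegrand d b y (r - Complex.I * s)‖ = ‖(r - Complex.I * s : ℂ)‖ *
      Real.exp (-(s * y) - ((1 + Complex.I * ((b * Real.tan (Real.pi * d / 2) : ℝ) : ℂ)) *
        (r - Complex.I * s : ℂ) ^ ((2 - d : ℝ) : ℂ)).re) := by
  rw [derivIntegrand, norm_mul, norm_neg, norm_mul, Complex.norm_I, one_mul, Complex.norm_exp,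
    Complex.sub_re]
  congr 3
  simp

/-- The basic estimate on the contour: decay in `r`, and growth of order
`exp (-(s y) + (1 + 5 d) s²)` in the depth `s` below the real axis. -/
theorem norm_derivIntegrand_le {d b y : ℝ} (h0 : 0 ≤ d) (h1 : d ≤ 1 / 10) (hb : |b| ≤ 1)
    {r s : ℝ} (hy : 1 ≤ y) (hr : 0 ≤ r) (hs : 0 ≤ s) (hsy : s ≤ y / 2)
    (hn : 1 ≤ ‖(r - Complex.I * s : ℂ)‖) :
    ‖derivIntegrand d b y (r - Complex.I * s)‖ ≤ y * (1 + r) *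
      Real.exp (-(s * y) + (1 + 5 * d) * s ^ 2 - 1 / 2 * y ^ (-d) * (r - 1)) := by
  rw [norm_derivIntegrand]
  have hle := re_mul_cpow_ge h0 h1 hb hr hn
  have hρ : ‖(r - Complex.I * s : ℂ)‖ ≤ y * (1 + r) := by
    refine (norm_sub_le _ _).trans ?_
    rw [norm_mul, Complex.norm_I, one_mul, Complex.norm_real, Complex.norm_real,
      Real.norm_of_nonneg hr, Real.norm_of_nonneg hs]
    nlinarith
  set ρ := ‖(r - Complex.I * s : ℂ)‖
  have hpow : y ^ (-d) * (r - 1) ≤ ρ ^ (-d) * r ^ 2 := by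
    have a1 : (y * (1 + r)) ^ (-d) ≤ ρ ^ (-d) :=
      Real.rpow_le_rpow_of_nonpos (by linarith) hρ (by linarith)
    rw [Real.mul_rpow (by linarith) (by linarith)] at a1
    have a2 : (1 + r)⁻¹ ≤ (1 + r) ^ (-d) := by
      rw [← Real.rpow_neg_one]
      exact Real.rpow_le_rpow_of_exponent_le (by linarith) (by linarith)
    have a3 : r - 1 ≤ (1 + r)⁻¹ * r ^ 2 := by
      rw [inv_mul_eq_div, le_div_iff₀ (by linarith)]; nlinarith
    have a4 : 0 ≤ y ^ (-d) := by positivity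
    calc y ^ (-d) * (r - 1) ≤ y ^ (-d) * ((1 + r) ^ (-d) * r ^ 2) := by
          gcongr; exact a3.trans (by gcongr)
      _ = (y ^ (-d) * (1 + r) ^ (-d)) * r ^ 2 := by ring
      _ ≤ _ := by gcongr
  refine mul_le_mul hρ (Real.exp_le_exp.2 ?_) (Real.exp_pos _).le (by positivity)
  linarith

/-! ### The derivative of the density as a Fourier integral -/

open MeasureTheory in
theorem integrable_abs_mul_exp_neg_abs_rpow {α : ℝ} (hα : 0 < α) :
    Integrable (fun t : ℝ => |t| * Real.exp (-|t| ^ α)) := by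
  have h : IntegrableOn (fun t : ℝ => t * Real.exp (-t ^ α)) (Set.Ioi 0) := by
    simpa using integrableOn_rpow_mul_exp_neg_rpow (p := α) (s := 1) (by norm_num) hα
  have h1 : IntegrableOn (fun t : ℝ => |t| * Real.exp (-|t| ^ α)) (Set.Ioi 0) :=
    h.congr_fun (fun t ht => by simp [abs_of_pos (Set.mem_Ioi.1 ht)]) measurableSet_Ioi
  have h2 : IntegrableOn (fun t : ℝ => |t| * Real.exp (-|t| ^ α)) (Set.Iic 0) := by
    rw [integrableOn_Iic_iff_integrableOn_Iio]
    simpa using h1.comp_neg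
  rw [← integrableOn_univ, ← Set.Iic_union_Ioi (a := (0 : ℝ))]
  exact h2.union h1

theorem measurable_stableCharFun (α β : ℝ) : Measurable (stableCharFun α β) := by
  have hs : Measurable Real.sign := by
    unfold Real.sign
    exact Measurable.ite measurableSet_Iio measurable_const
      (Measurable.ite measurableSet_Ioi measurable_const measurable_const)
  unfold stableCharFun
  fun_prop

open MeasureTheory in
/-- Differentiation under the integral sign. -/
theorem hasDerivAt_stableDensity {α : ℝ} (hα : 0 < α) (β x : ℝ) :
    Integrable (fun t : ℝ => -(Complex.I * t) * Complex.exp (-(Complex.I * t * x)) *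
      stableCharFun α β t) ∧
    HasDerivAt (stableDensity α β) (1 / (2 * (Real.pi : ℂ)) * ∫ t : ℝ,
      -(Complex.I * t) * Complex.exp (-(Complex.I * t * x)) * stableCharFun α β t).re x := by
  have hm := measurable_stableCharFun α β
  have hexp : ∀ t x : ℝ, ‖Complex.exp (-(Complex.I * t * x))‖ = 1 := fun t x => by
    rw [Complex.norm_exp]; simp
  have key := hasDerivAt_integral_of_dominated_loc_of_deriv_le (μ := volume) (𝕜 := ℝ)
    (F := fun (x t : ℝ) => Complex.exp (-(Complex.I * t * x)) * stableCharFun α β t)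
    (F' := fun (x t : ℝ) => -(Complex.I * t) * Complex.exp (-(Complex.I * t * x)) *
      stableCharFun α β t) (x₀ := x) (s := Set.univ)
    (bound := fun t => |t| * Real.exp (-|t| ^ α)) Filter.univ_mem
    (Filter.Eventually.of_forall fun x => by
      refine Measurable.aestronglyMeasurable ?_
      fun_prop)
    (by
      refine (integrable_exp_neg_abs_rpow hα).mono' ?_ (Filter.Eventually.of_forall fun t => ?_)
      · refine Measurable.aestronglyMeasurable ?_
        fun_prop
      · rw [norm_mul, hexp, norm_stableCharFun, one_mul])
    (by
      refine Measurable.aestronglyMeasurable ?_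
      fun_prop)
    (Filter.Eventually.of_forall fun t x _ => by
      rw [norm_mul, norm_mul, hexp, norm_stableCharFun]
      simp)
    (integrable_abs_mul_exp_neg_abs_rpow hα)
    (Filter.Eventually.of_forall fun t x _ => by
      have h1 : HasDerivAt (fun x : ℝ => -(Complex.I * t * x)) (-(Complex.I * t)) x := by
        simpa using ((Complex.ofRealCLM.hasDerivAt (x := x)).const_mul (Complex.I * t)).fun_neg
      have h2 := h1.cexp.mul_const (stableCharFun α β t)
      exact h2.congr_deriv (by ring))
  refine ⟨key.1, ?_⟩
  have := (Complex.reCLM.hasFDerivAt.comp_hasDerivAt x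
    (key.2.const_mul (1 / (2 * (Real.pi : ℂ)))))
  exact this

theorem rpow_mul_rpow_one_sub_sub_one {t : ℝ} (ht : 0 < t) (α : ℝ) :
    t ^ α * (t ^ (1 - α) - 1) = t - t ^ α := by
  rw [mul_sub, ← Real.rpow_add ht]; simp

/-- On the positive half-line the Zolotarev parameterization turns into a shift by `ζ`. -/
theorem fourierIntegrand_eq_derivIntegrand (d β x : ℝ) {t : ℝ} (ht : 0 < t) :
    -(Complex.I * t) * Complex.exp (-(Complex.I * t * x)) * stableCharFun (2 - d) β t =
      derivIntegrand d β (x - stableShift (2 - d) β) t := by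
  have htan : Real.tan (Real.pi * (2 - d) / 2) = -Real.tan (Real.pi * d / 2) := by
    rw [show Real.pi * (2 - d) / 2 = Real.pi - Real.pi * d / 2 by ring, Real.tan_pi_sub]
  rw [derivIntegrand, stableCharFun, mul_assoc, ← Complex.exp_add, stableShift, htan,
    abs_of_pos ht, Real.sign_of_pos ht, ← Complex.ofReal_cpow ht.le]
  congr 2
  have h := rpow_mul_rpow_one_sub_sub_one ht (2 - d)
  have h' : ((t ^ (2 - d) : ℝ) : ℂ) * (((t ^ (1 - (2 - d)) : ℝ) : ℂ) - 1) =
      t - ((t ^ (2 - d) : ℝ) : ℂ) := by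
    exact_mod_cast h
  push_cast
  linear_combination Complex.I * β * (Complex.tan (Real.pi * d / 2)) * h'

theorem re_fourierIntegrand_abs (α β x t : ℝ) :
    (-(Complex.I * (|t| : ℝ)) * Complex.exp (-(Complex.I * (|t| : ℝ) * x)) *
      stableCharFun α β |t|).re =
    (-(Complex.I * t) * Complex.exp (-(Complex.I * t * x)) * stableCharFun α β t).re := by
  rcases le_total 0 t with h | h
  · rw [abs_of_nonneg h]
  · rw [abs_of_nonpos h, ← Complex.conj_re]
    congr 1
    simp only [stableCharFun, map_mul, map_neg, ← Complex.exp_conj, Complex.conj_ofReal,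
      Complex.conj_I, map_add, map_one, abs_neg, Real.sign_neg]
    push_cast
    congr 1
    · congr 1
      · ring
      · congr 1; ring
    · congr 1; ring

open MeasureTheory in
theorem integrableOn_derivIntegrand {d : ℝ} (hd : d < 2) (β y : ℝ) :
    IntegrableOn (fun t : ℝ => derivIntegrand d β y t) (Set.Ioi 0) := by
  have h := (hasDerivAt_stableDensity (α := 2 - d) (by linarith) β
    (y + stableShift (2 - d) β)).1.integrableOn (s := Set.Ioi 0)
  refine h.congr_fun (fun t ht => ?_) measurableSet_Ioi
  beta_reduce
  rw [fourierIntegrand_eq_derivIntegrand d β _ ht, add_sub_cancel_right]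

open MeasureTheory in
theorem hasDerivAt_stableDensity_halfLine {d : ℝ} (hd : d < 2) (β x : ℝ) :
    HasDerivAt (stableDensity (2 - d) β) (1 / Real.pi *
      (∫ t in Set.Ioi (0 : ℝ), derivIntegrand d β (x - stableShift (2 - d) β) t).re) x := by
  obtain ⟨hi, h⟩ := hasDerivAt_stableDensity (α := 2 - d) (by linarith) β x
  convert h using 1
  have e1 : (1 / (2 * (Real.pi : ℂ))) = ((1 / (2 * Real.pi) : ℝ) : ℂ) := by push_cast; rfl
  have e2 := integral_re hi
  simp only [RCLike.re_to_complex] at e2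
  have e3 := integral_re (integrableOn_derivIntegrand hd β (x - stableShift (2 - d) β))
  simp only [RCLike.re_to_complex] at e3
  rw [e1, Complex.re_ofReal_mul, ← e2, ← e3]
  have e4 := integral_comp_abs (f := fun t : ℝ => (-(Complex.I * t) *
    Complex.exp (-(Complex.I * t * x)) * stableCharFun (2 - d) β t).re)
  simp only [re_fourierIntegrand_abs] at e4
  have e5 : ∫ t in Set.Ioi (0 : ℝ), (-(Complex.I * t) * Complex.exp (-(Complex.I * t * x)) *
      stableCharFun (2 - d) β t).re = ∫ t in Set.Ioi (0 : ℝ),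
      (derivIntegrand d β (x - stableShift (2 - d) β) t).re :=
    setIntegral_congr_fun measurableSet_Ioi fun t ht => by
      rw [fourierIntegrand_eq_derivIntegrand d β x (Set.mem_Ioi.1 ht)]
  rw [e4, e5]
  ring

open MeasureTheory in
/-- Reflection: the skewness changes sign with the argument. -/
theorem re_integral_derivIntegrand_neg {d : ℝ} (hd : d < 2) (b y : ℝ) :
    (∫ t in Set.Ioi (0 : ℝ), derivIntegrand d b (-y) t).re =
      -(∫ t in Set.Ioi (0 : ℝ), derivIntegrand d (-b) y t).re := by
  have e1 := integral_re (integrableOn_derivIntegrand hd b (-y))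
  have e2 := integral_re (integrableOn_derivIntegrand hd (-b) y)
  simp only [RCLike.re_to_complex] at e1 e2
  rw [← e1, ← e2, ← integral_neg]
  refine setIntegral_congr_fun measurableSet_Ioi (fun t ht => ?_)
  rw [← Complex.conj_re, ← Complex.neg_re]
  congr 1
  rw [derivIntegrand, derivIntegrand, ← Complex.ofReal_cpow (le_of_lt ht)]
  simp only [map_mul, map_neg, ← Complex.exp_conj, Complex.conj_ofReal,
      Complex.conj_I, map_add, map_one, map_sub]
  push_cast
  rw [← neg_mul _ (Complex.exp _)]
  congr 1
  · ring
  · congr 1; ring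

/-! ### Deformation of the contour through the point `-iy/2` -/

theorem continuousAt_derivIntegrand {d : ℝ} (hd : d < 2) (b y : ℝ) {z : ℂ} (hz : 0 ≤ z.re) :
    ContinuousAt (derivIntegrand d b y) z := by
  have : ContinuousAt (fun z : ℂ => z ^ ((2 - d : ℝ) : ℂ)) z :=
    Complex.continuousAt_cpow_const_of_re_pos (Or.inl hz) (by simpa using hd)
  unfold derivIntegrand
  fun_prop

theorem differentiableAt_derivIntegrand (d b y : ℝ) {z : ℂ} (hz : 0 < z.re) :
    DifferentiableAt ℂ (derivIntegrand d b y) z := by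
  have : DifferentiableAt ℂ (fun z : ℂ => z ^ ((2 - d : ℝ) : ℂ)) z :=
    differentiableAt_id.cpow_const (Or.inl hz)
  unfold derivIntegrand
  fun_prop

theorem integral_derivIntegrand_rectangle {d : ℝ} (hd : d < 2) (b y : ℝ) {R : ℝ} (hR : 0 ≤ R)
    (s : ℝ) :
    ∫ r in (0 : ℝ)..R, derivIntegrand d b y r =
      (∫ r in (0 : ℝ)..R, derivIntegrand d b y (r - Complex.I * s)) +
      Complex.I * (∫ u in (0 : ℝ)..s, derivIntegrand d b y (R - Complex.I * u)) -
      Complex.I * ∫ u in (0 : ℝ)..s, derivIntegrand d b y ((0 : ℝ) - Complex.I * u) := by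
  have h := Complex.integral_boundary_rect_eq_zero_of_differentiable_on_off_countable
    (derivIntegrand d b y) ⟨0, -s⟩ ⟨R, 0⟩ ∅ Set.countable_empty
    (fun z hz => (continuousAt_derivIntegrand hd b y (by
      have := hz.1
      simp only [Set.mem_preimage, Set.uIcc_of_le hR] at this
      exact this.1)).continuousWithinAt)
    (fun z hz => differentiableAt_derivIntegrand d b y (by
      have := hz.1.1
      simp only [Set.mem_preimage, min_eq_left hR] at this
      exact this.1))
  have hflip : ∀ t : ℝ, ∫ u in (-s)..0, derivIntegrand d b y (t + u * Complex.I) =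
      ∫ u in (0 : ℝ)..s, derivIntegrand d b y (t - Complex.I * u) := fun t => by
    rw [← neg_zero, ← intervalIntegral.integral_comp_neg]
    simp [mul_comm, sub_eq_add_neg]
  simp only [hflip, smul_eq_mul, Complex.ofReal_zero, zero_mul, add_zero] at h
  have h2 : ∀ r : ℝ, (r + ((-s : ℝ) : ℂ) * Complex.I : ℂ) = r - Complex.I * s := fun r => by
    push_cast; ring
  simp only [h2] at h
  have h3 := hflip 0
  rw [Complex.ofReal_zero] at h3
  rw [h3] at h
  rw [Complex.ofReal_zero]
  linear_combination -h

theorem le_norm_sub_I_mul_left (r s : ℝ) : r ≤ ‖(r - Complex.I * s : ℂ)‖ := by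
  have := Complex.re_le_norm (r - Complex.I * s : ℂ)
  simpa using this

theorem le_norm_sub_I_mul_right (r s : ℝ) : s ≤ ‖(r - Complex.I * s : ℂ)‖ := by
  have := (neg_le_abs _).trans (Complex.abs_im_le_norm (r - Complex.I * s : ℂ))
  simpa using this

theorem integrableOn_one_add_mul_exp {c : ℝ} (hc : 0 < c) :
    MeasureTheory.IntegrableOn (fun r : ℝ => (1 + r) * Real.exp (-c * r)) (Set.Ioi 0) := by
  refine integrable_of_isBigO_exp_neg (b := c / 2) (by positivity) (by fun_prop) ?_
  have h := isLittleO_pow_exp_pos_mul_atTop (k := 1) (b := c / 2) (by positivity)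
  have h1 : (fun r : ℝ => 1 + r) =O[Filter.atTop] fun r => Real.exp (c / 2 * r) := by
    have h0 := isLittleO_pow_exp_pos_mul_atTop (k := 0) (b := c / 2) (by positivity)
    simpa using h0.isBigO.add h.isBigO
  refine (h1.mul (Asymptotics.isBigO_refl (fun r : ℝ => Real.exp (-c * r)) _)).congr_right
    fun r => ?_
  rw [← Real.exp_add]
  congr 1
  ring

open MeasureTheory in
theorem integrableOn_derivIntegrand_shift {d b y : ℝ} (h0 : 0 ≤ d) (h1 : d ≤ 1 / 10)
    (hb : |b| ≤ 1) (hy : 2 ≤ y) :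
    IntegrableOn (fun r : ℝ => derivIntegrand d b y (r - Complex.I * (y / 2 : ℝ))) (Set.Ioi 0) := by
  have hc : 0 < 1 / 2 * y ^ (-d) := by positivity
  refine ((integrableOn_one_add_mul_exp hc).const_mul (y * Real.exp (-(y / 2 * y) +
    (1 + 5 * d) * (y / 2) ^ 2 + 1 / 2 * y ^ (-d)))).mono' ?_ ?_
  · refine ContinuousOn.aestronglyMeasurable (fun r hr => ?_) measurableSet_Ioi
    have h2 : ContinuousAt (fun r : ℝ => (r - Complex.I * (y / 2 : ℝ) : ℂ)) r := by fun_prop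
    exact (ContinuousAt.comp (g := derivIntegrand d b y) (continuousAt_derivIntegrand
      (by linarith) b y (by simpa using le_of_lt hr)) h2).continuousWithinAt
  · refine (ae_restrict_iff' measurableSet_Ioi).2 (Filter.Eventually.of_forall fun r hr => ?_)
    refine (norm_derivIntegrand_le h0 h1 hb (by linarith) (le_of_lt hr) (by linarith) le_rfl
      (le_trans (by linarith) (le_norm_sub_I_mul_right r (y / 2)))).trans (le_of_eq ?_)
    rw [mul_mul_mul_comm, mul_mul_mul_comm y, mul_assoc y, mul_assoc y, mul_left_comm (Real.exp _),
      ← Real.exp_add]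
    congr 3
    ring

open MeasureTheory Filter in
/-- The Fourier integral as the sum of an integral along the horizontal line through the saddle
point `-iy/2` of the Gaussian exponent and of one along the imaginary axis. -/
theorem integral_derivIntegrand_eq_contour {d b y : ℝ} (h0 : 0 ≤ d) (h1 : d ≤ 1 / 10)
    (hb : |b| ≤ 1) (hy : 2 ≤ y) :
    ∫ r in Set.Ioi (0 : ℝ), derivIntegrand d b y r =
      (∫ r in Set.Ioi (0 : ℝ), derivIntegrand d b y (r - Complex.I * (y / 2 : ℝ))) -
      Complex.I * ∫ u in (0 : ℝ)..(y / 2), derivIntegrand d b y ((0 : ℝ) - Complex.I * u) := by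
  have t1 := intervalIntegral_tendsto_integral_Ioi 0
    (integrableOn_derivIntegrand (show d < 2 by linarith) b y) tendsto_id
  have t2 := intervalIntegral_tendsto_integral_Ioi 0
    (integrableOn_derivIntegrand_shift h0 h1 hb hy) tendsto_id
  have t3 : Tendsto (fun R : ℝ => ∫ u in (0 : ℝ)..(y / 2),
      derivIntegrand d b y (R - Complex.I * u)) atTop (nhds 0) := by
    have hc : 0 < 1 / 2 * y ^ (-d) := by positivity
    have hlim : Tendsto (fun R : ℝ => y * (1 + R) * Real.exp (1 / 2 * y ^ (-d)) *
        Real.exp (-(1 / 2 * y ^ (-d)) * R) * |y / 2 - 0|) atTop (nhds 0) := by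
      have a1 := tendsto_rpow_mul_exp_neg_mul_atTop_nhds_zero 1 _ hc
      have a0 := tendsto_rpow_mul_exp_neg_mul_atTop_nhds_zero 0 _ hc
      have := ((a0.add a1).const_mul (y * Real.exp (1 / 2 * y ^ (-d)) * |y / 2 - 0|))
      simp only [Real.rpow_one, Real.rpow_zero, add_zero, mul_zero] at this
      refine this.congr fun R => ?_
      ring
    refine squeeze_zero_norm' ?_ hlim
    filter_upwards [eventually_ge_atTop 1] with R hR
    refine intervalIntegral.norm_integral_le_of_norm_le_const fun u hu => ?_
    rw [Set.uIoc_of_le (by linarith)] at hu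
    refine (norm_derivIntegrand_le h0 h1 hb (by linarith) (by linarith) hu.1.le hu.2
      (hR.trans (le_norm_sub_I_mul_left R u))).trans ?_
    rw [mul_assoc _ (Real.exp _) (Real.exp _), ← Real.exp_add]
    have hneg : -(u * y) + (1 + 5 * d) * u ^ 2 ≤ 0 := by
      have := hu.1; have := hu.2
      have : (1 + 5 * d) * u ≤ 2 * u := by gcongr; linarith
      nlinarith
    have : 0 ≤ y * (1 + R) := by nlinarith
    gcongr
    linarith
  have t4 := (t2.add (t3.const_mul Complex.I)).sub_const
    (Complex.I * ∫ u in (0 : ℝ)..(y / 2), derivIntegrand d b y ((0 : ℝ) - Complex.I * u))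
  rw [mul_zero, add_zero] at t4
  refine tendsto_nhds_unique t1 (t4.congr' ?_)
  filter_upwards [eventually_ge_atTop 0] with R hR
  exact (integral_derivIntegrand_rectangle (by linarith) b y hR _).symm

/-! ### The integral along the imaginary axis: the power law -/

/-- The growth rate of the modulus of the characteristic function along the negative imaginary
axis. -/
noncomputable def axisRate (d b : ℝ) : ℝ :=
  Real.cos (Real.pi * d / 2) - b * Real.tan (Real.pi * d / 2) * Real.sin (Real.pi * d / 2)

theorem derivIntegrand_neg_I_mul {d : ℝ} (h0 : 0 ≤ d) (h1 : d ≤ 1 / 10) (b y : ℝ) {u : ℝ}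
    (hu : 0 < u) :
    derivIntegrand d b y ((0 : ℝ) - Complex.I * u) = -(u : ℂ) *
      Complex.exp (((-(u * y) + axisRate d b * u ^ (2 - d) : ℝ) : ℂ) +
        ((Real.sin (Real.pi * d / 2) * (1 + b) * u ^ (2 - d) : ℝ) : ℂ) * Complex.I) := by
  have hcos : Real.cos (Real.pi * d / 2) ≠ 0 := by
    refine (Real.cos_pos_of_mem_Ioo ⟨?_, ?_⟩).ne' <;> nlinarith [Real.pi_pos]
  have htan : Real.tan (Real.pi * d / 2) * Real.cos (Real.pi * d / 2) =
      Real.sin (Real.pi * d / 2) := Real.tan_mul_cos hcos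
  have hz : ((0 : ℝ) - Complex.I * u : ℂ) = u * -Complex.I := by push_cast; ring
  have hpow : (u * -Complex.I : ℂ) ^ ((2 - d : ℝ) : ℂ) = -((u ^ (2 - d) : ℝ) : ℂ) *
      ((Real.cos (Real.pi * d / 2) : ℝ) + (Real.sin (Real.pi * d / 2) : ℝ) * Complex.I) := by
    have hne : (u * -Complex.I : ℂ) ≠ 0 := by simp [hu.ne']
    rw [Complex.cpow_def_of_ne_zero hne, Complex.log_ofReal_mul hu (by simp), Complex.log_neg_I,
      Real.rpow_def_of_pos hu, Complex.ofReal_cos, Complex.ofReal_sin, ← Complex.exp_mul_I,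
      Complex.ofReal_exp, neg_mul (Complex.exp _), ← Complex.exp_add, ← mul_neg_one (Complex.exp _),
      ← Complex.exp_neg_pi_mul_I,
      ← Complex.exp_add]
    congr 1
    push_cast
    ring
  rw [hz, derivIntegrand, hpow]
  have htan' : ((Real.tan (Real.pi * d / 2) : ℝ) : ℂ) * (Real.cos (Real.pi * d / 2) : ℝ) =
      (Real.sin (Real.pi * d / 2) : ℝ) := by exact_mod_cast htan
  congr 1
  · linear_combination u * Complex.I_sq
  · congr 1
    rw [axisRate]
    simp only [Complex.ofReal_add, Complex.ofReal_sub, Complex.ofReal_mul, Complex.ofReal_neg,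
      Complex.ofReal_one]
    generalize ((Real.tan (Real.pi * d / 2) : ℝ) : ℂ) = τ at *
    generalize ((Real.sin (Real.pi * d / 2) : ℝ) : ℂ) = σ at *
    generalize ((Real.cos (Real.pi * d / 2) : ℝ) : ℂ) = c at *
    generalize ((u ^ (2 - d) : ℝ) : ℂ) = w at *
    linear_combination (u * y + b * τ * w * σ) * Complex.I_sq + Complex.I * b * w * htan'

/-- The integrand along the imaginary axis, rescaled by `u = v / y`. The factors `sinc` come from
`sin x = x * sinc x` and carry the order `d` of the integral out of the integral sign. -/
noncomputable def axisIntegrand (b d y v : ℝ) : ℝ :=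
  v * Real.exp (-v) * Real.exp (axisRate d b * (v / y) ^ (2 - d)) * v ^ (2 - d) *
    (Real.pi / 2 * (1 + b) * Real.sinc (Real.pi * d / 2) *
      Real.sinc (Real.sin (Real.pi * d / 2) * (1 + b) * (v / y) ^ (2 - d)))

theorem sin_eq_mul_sinc (x : ℝ) : Real.sin x = x * Real.sinc x := by
  rcases eq_or_ne x 0 with rfl | h
  · simp
  · rw [Real.sinc_of_ne_zero h]; field_simp

open MeasureTheory in
theorem re_axis_integral {d : ℝ} (h0 : 0 ≤ d) (h1 : d ≤ 1 / 10) (b : ℝ) {y : ℝ} (hy : 0 < y) :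
    (-(Complex.I * ∫ u in (0 : ℝ)..(y / 2), derivIntegrand d b y ((0 : ℝ) - Complex.I * u))).re =
      -(d * y ^ (d - 4)) *
        ∫ v in Set.Ioi (0 : ℝ), (Set.Iic (y ^ 2 / 2)).indicator (axisIntegrand b d y) v := by
  have hint : IntervalIntegrable (fun u : ℝ => derivIntegrand d b y ((0 : ℝ) - Complex.I * u))
      volume 0 (y / 2) := by
    refine ContinuousOn.intervalIntegrable fun u _ => ContinuousAt.continuousWithinAt ?_
    exact ContinuousAt.comp (g := derivIntegrand d b y) (continuousAt_derivIntegrand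
      (by linarith) b y (by simp)) (by fun_prop)
  have him := Complex.imCLM.intervalIntegral_comp_comm hint
  simp only [Complex.imCLM_apply] at him
  have hre : (-(Complex.I * ∫ u in (0 : ℝ)..(y / 2),
      derivIntegrand d b y ((0 : ℝ) - Complex.I * u))).re = ∫ u in (0 : ℝ)..(y / 2),
        (derivIntegrand d b y ((0 : ℝ) - Complex.I * u)).im := by
    rw [him]; simp
  have hscale := intervalIntegral.integral_comp_div (a := 0) (b := y ^ 2 / 2)
    (fun u : ℝ => (derivIntegrand d b y ((0 : ℝ) - Complex.I * u)).im) hy.ne'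
  have hend : y ^ 2 / 2 / y = y / 2 := by field_simp
  rw [zero_div, hend, smul_eq_mul] at hscale
  have hscale' : ∫ u in (0 : ℝ)..(y / 2), (derivIntegrand d b y ((0 : ℝ) - Complex.I * u)).im =
      (∫ v in (0 : ℝ)..(y ^ 2 / 2),
        (derivIntegrand d b y ((0 : ℝ) - Complex.I * (v / y : ℝ))).im) / y := by
    rw [hscale, mul_div_cancel_left₀ _ hy.ne']
  rw [hre, setIntegral_indicator measurableSet_Iic, Set.Ioi_inter_Iic,
    ← intervalIntegral.integral_of_le (by positivity), ← intervalIntegral.integral_const_mul,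
    hscale', ← intervalIntegral.integral_div]
  refine intervalIntegral.integral_congr_ae (Filter.Eventually.of_forall fun v hv => ?_)
  rw [Set.uIoc_of_le (by positivity)] at hv
  have hv0 : 0 < v := hv.1
  have hvy : 0 < v / y := by positivity
  rw [derivIntegrand_neg_I_mul h0 h1 b y hvy, ← Complex.ofReal_neg, Complex.im_ofReal_mul,
    Complex.exp_add, ← Complex.ofReal_exp, Complex.im_ofReal_mul, Complex.exp_ofReal_mul_I_im,
    axisIntegrand, sin_eq_mul_sinc (Real.sin _ * _ * _)]
  have hsd : Real.sin (Real.pi * d / 2) = Real.pi * d / 2 * Real.sinc (Real.pi * d / 2) :=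
    sin_eq_mul_sinc _
  have hpow : (v / y) ^ (2 - d) = v ^ (2 - d) * y ^ (d - 4) * y ^ 2 := by
    rw [Real.div_rpow hv0.le hy.le, div_eq_mul_inv, ← Real.rpow_neg hy.le, mul_assoc,
      ← Real.rpow_natCast, ← Real.rpow_add hy]
    congr 2
    push_cast
    ring
  rw [div_mul_cancel₀ _ hy.ne', Real.exp_add]
  generalize Real.sinc (Real.sin (Real.pi * d / 2) * (1 + b) * (v / y) ^ (2 - d)) = S
  generalize Real.exp (axisRate d b * (v / y) ^ (2 - d)) = X
  rw [hsd, hpow]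
  field_simp

theorem axisRate_le {d b : ℝ} (h0 : 0 ≤ d) (h1 : d ≤ 1 / 10) (hb : |b| ≤ 1) :
    axisRate d b ≤ 3 / 2 := by
  obtain ⟨ht0, ht1⟩ := tan_pi_mul_div_two_mem_Icc h0 h1
  have h2 : |b * Real.tan (Real.pi * d / 2) * Real.sin (Real.pi * d / 2)| ≤
      1 * (Real.pi * d) * 1 := by
    rw [abs_mul, abs_mul, abs_of_nonneg ht0]
    gcongr
    exact Real.abs_sin_le_one _
  have h3 := Real.cos_le_one (Real.pi * d / 2)
  have h4 := neg_abs_le (b * Real.tan (Real.pi * d / 2) * Real.sin (Real.pi * d / 2))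
  rw [axisRate]
  nlinarith [Real.pi_lt_d2]

theorem rpow_le_one_add_sq {x p : ℝ} (hx : 0 ≤ x) (h0 : 0 ≤ p) (h2 : p ≤ 2) :
    x ^ p ≤ 1 + x ^ 2 := by
  rcases le_total x 1 with h | h
  · have := Real.rpow_le_one hx h h0
    nlinarith
  · have := Real.rpow_le_rpow_of_exponent_le h h2
    rw [Real.rpow_two] at this
    linarith

/-- The domination on the axis: since `v ≤ y² / 2`, the growing factor has exponent at most
`3/2 (1 + v / 2)`, which leaves a quarter of the decay of `exp (-v)`. -/
theorem abs_axisIntegrand_le {d b y v : ℝ} (h0 : 0 ≤ d) (h1 : d ≤ 1 / 10) (hb : |b| ≤ 1)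
    (hy : 0 < y) (hv : 0 ≤ v) (hvy : v ≤ y ^ 2 / 2) :
    |axisIntegrand b d y v| ≤ Real.pi * Real.exp (3 / 2) *
      ((v ^ 1 + v ^ 3) * Real.exp (-(1 / 4) * v)) := by
  have hw : (v / y) ^ (2 - d) ≤ 1 + v / 2 := by
    refine (rpow_le_one_add_sq (by positivity) (by linarith) (by linarith)).trans ?_
    rw [div_pow]
    have : v ^ 2 / y ^ 2 ≤ v / 2 := by
      rw [div_le_iff₀ (by positivity)]; nlinarith
    linarith
  have hw0 : 0 ≤ (v / y) ^ (2 - d) := by positivity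
  have he : Real.exp (axisRate d b * (v / y) ^ (2 - d)) ≤ Real.exp (3 / 2 + 3 / 4 * v) := by
    refine Real.exp_le_exp.2 ?_
    have := mul_le_mul_of_nonneg_right (axisRate_le h0 h1 hb) hw0
    linarith
  have hp : v ^ (2 - d) ≤ 1 + v ^ 2 := rpow_le_one_add_sq hv (by linarith) (by linarith)
  have hb2 : |1 + b| ≤ 2 := by rw [abs_le] at hb ⊢; constructor <;> linarith
  rw [axisIntegrand]
  simp only [abs_mul, abs_of_nonneg hv, Real.abs_exp, abs_of_pos Real.pi_div_two_pos]
  rw [abs_of_nonneg (Real.rpow_nonneg hv _)]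
  calc _ ≤ v * Real.exp (-v) * Real.exp (3 / 2 + 3 / 4 * v) * (1 + v ^ 2) *
        (Real.pi / 2 * 2 * 1 * 1) := by
        gcongr <;> exact Real.abs_sinc_le_one _
    _ = _ := by
        rw [show -(1 / 4) * v = -v + 3 / 4 * v by ring, Real.exp_add, Real.exp_add]
        ring

open MeasureTheory in
theorem integrableOn_pow_mul_exp (n : ℕ) {c : ℝ} (hc : 0 < c) :
    IntegrableOn (fun v : ℝ => v ^ n * Real.exp (-c * v)) (Set.Ioi 0) := by
  have := integrableOn_rpow_mul_exp_neg_mul_rpow (p := 1) (s := n) (b := c)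
    (by linarith [(Nat.cast_nonneg n : (0 : ℝ) ≤ n)]) one_pos hc
  simpa using this

theorem integral_cube_mul_exp : ∫ v in Set.Ioi (0 : ℝ), v ^ 3 * Real.exp (-v) = 6 := by
  have h := Real.Gamma_eq_integral (s := 4) (by norm_num)
  have h2 : Real.Gamma 4 = 6 := by norm_num [Nat.factorial]
  rw [← h2, h]
  refine MeasureTheory.setIntegral_congr_fun measurableSet_Ioi fun v _ => ?_
  norm_num
  rw [mul_comm]

open MeasureTheory Filter in
/-- The limit `3 π (1 + b)` is `Γ(4) = 6` times the limit `π / 2 (1 + b)` of the last factor of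
`axisIntegrand`. -/
theorem tendsto_integral_axisIntegrand {b : ℝ} (hb : |b| ≤ 1) :
    Tendsto (fun p : ℝ × ℝ => ∫ v in Set.Ioi (0 : ℝ),
      (Set.Iic (p.2 ^ 2 / 2)).indicator (axisIntegrand b p.1 p.2) v)
      (nhdsWithin 0 (Set.Ici 0) ×ˢ atTop) (nhds (3 * Real.pi * (1 + b))) := by
  have hd : Tendsto (fun p : ℝ × ℝ => p.1) (nhdsWithin 0 (Set.Ici 0) ×ˢ atTop) (nhds (0 : ℝ)) :=
    tendsto_fst.mono_right nhdsWithin_le_nhds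
  have hy : Tendsto (fun p : ℝ × ℝ => p.2) (nhdsWithin (0 : ℝ) (Set.Ici 0) ×ˢ atTop) atTop :=
    tendsto_snd
  have hd0 : ∀ᶠ p : ℝ × ℝ in nhdsWithin 0 (Set.Ici 0) ×ˢ atTop, 0 ≤ p.1 :=
    tendsto_fst.eventually self_mem_nhdsWithin
  have hd1 : ∀ᶠ p : ℝ × ℝ in nhdsWithin 0 (Set.Ici 0) ×ˢ atTop, p.1 ≤ 1 / 10 :=
    hd.eventually (eventually_le_nhds (by norm_num))
  have hval : ∫ v in Set.Ioi (0 : ℝ), v ^ 3 * Real.exp (-v) * (Real.pi / 2 * (1 + b)) =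
      3 * Real.pi * (1 + b) := by
    rw [integral_mul_const, integral_cube_mul_exp]; ring
  rw [← hval]
  refine tendsto_integral_filter_of_dominated_convergence (fun v => Real.pi * Real.exp (3 / 2) *
      ((v ^ 1 + v ^ 3) * Real.exp (-(1 / 4) * v))) ?_ ?_ ?_ ?_
  · refine Eventually.of_forall fun p => ?_
    refine (Measurable.indicator ?_ measurableSet_Iic).aestronglyMeasurable
    have := Real.continuous_sinc.measurable
    unfold axisIntegrand
    fun_prop
  · filter_upwards [hd0, hd1, hy.eventually_gt_atTop 0] with p p0 p1 py
    refine (ae_restrict_iff' measurableSet_Ioi).2 (Eventually.of_forall fun v hv => ?_)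
    have hv0 : 0 ≤ v := le_of_lt hv
    by_cases h : v ∈ Set.Iic (p.2 ^ 2 / 2)
    · rw [Set.indicator_of_mem h, Real.norm_eq_abs]
      exact abs_axisIntegrand_le p0 p1 hb py hv0 h
    · rw [Set.indicator_of_notMem h, norm_zero]
      positivity
  · simp only [add_mul]
    exact ((integrableOn_pow_mul_exp 1 (by norm_num)).add
      (integrableOn_pow_mul_exp 3 (by norm_num))).const_mul _
  · refine (ae_restrict_iff' measurableSet_Ioi).2 (Eventually.of_forall fun v hv => ?_)
    have hv0 : 0 < v := hv
    have hpi : Tendsto (fun p : ℝ × ℝ => Real.pi * p.1 / 2) (nhdsWithin 0 (Set.Ici 0) ×ˢ atTop)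
        (nhds 0) := by
      simpa using (hd.const_mul Real.pi).div_const 2
    have hsin := (Real.continuous_sin.tendsto 0).comp hpi
    have hcos := (Real.continuous_cos.tendsto 0).comp hpi
    have htan := (Real.continuousAt_tan (x := 0) |>.2 (by simp)).tendsto.comp hpi
    have hexp : Tendsto (fun p : ℝ × ℝ => 2 - p.1) (nhdsWithin 0 (Set.Ici 0) ×ˢ atTop)
        (nhds (2 - 0)) := hd.const_sub 2
    have hw : Tendsto (fun p : ℝ × ℝ => (v / p.2) ^ (2 - p.1))
        (nhdsWithin 0 (Set.Ici 0) ×ˢ atTop) (nhds (0 ^ (2 - 0 : ℝ))) :=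
      (hy.const_div_atTop v).rpow hexp (Or.inr (by norm_num))
    have hrate : Tendsto (fun p : ℝ × ℝ => axisRate p.1 b) (nhdsWithin 0 (Set.Ici 0) ×ˢ atTop)
        (nhds (Real.cos 0 - b * Real.tan 0 * Real.sin 0)) :=
      hcos.sub ((htan.const_mul b).mul hsin)
    have hS := (Real.continuous_sinc.tendsto 0).comp hpi
    have hS2 := (Real.continuous_sinc.tendsto _).comp ((hsin.mul_const (1 + b)).mul hw)
    have hX := (Real.continuous_exp.tendsto _).comp (hrate.mul hw)
    have hvp : Tendsto (fun p : ℝ × ℝ => v ^ (2 - p.1)) (nhdsWithin 0 (Set.Ici 0) ×ˢ atTop)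
        (nhds (v ^ (2 - 0 : ℝ))) := tendsto_const_nhds.rpow hexp (Or.inl hv0.ne')
    have hall := ((hX.const_mul (v * Real.exp (-v))).mul hvp).mul
      ((hS.const_mul (Real.pi / 2 * (1 + b))).mul hS2)
    have hlim : v ^ 3 * Real.exp (-v) * (Real.pi / 2 * (1 + b)) =
        v * Real.exp (-v) * Real.exp ((Real.cos 0 - b * Real.tan 0 * Real.sin 0) *
          0 ^ (2 - 0 : ℝ)) * v ^ (2 - 0 : ℝ) * (Real.pi / 2 * (1 + b) * Real.sinc 0 *
          Real.sinc (Real.sin 0 * (1 + b) * 0 ^ (2 - 0 : ℝ))) := by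
      have e1 : (0 : ℝ) ^ (2 - 0 : ℝ) = 0 := by norm_num
      have e2 : v ^ (2 - 0 : ℝ) = v ^ 2 := by norm_num
      rw [e1, e2]
      simp only [mul_zero, Real.exp_zero, Real.sinc_zero]
      ring
    rw [hlim]
    refine hall.congr' ?_
    filter_upwards [hy.eventually_ge_atTop 1, hy.eventually_ge_atTop (2 * v)] with p p1 pv
    rw [Set.indicator_of_mem (show v ∈ Set.Iic (p.2 ^ 2 / 2) by simp only [Set.mem_Iic]; nlinarith)]
    simp [axisIntegrand]

/-! ### The integral along the horizontal line: the Gaussian part -/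

theorem norm_sub_I_mul_half_le {r y : ℝ} (hr : 0 ≤ r) (hy : 1 ≤ y) :
    ‖(r - Complex.I * (y / 2 : ℝ) : ℂ)‖ ≤ y * (1 + r) := by
  refine (norm_sub_le _ _).trans ?_
  rw [norm_mul, Complex.norm_I, one_mul, Complex.norm_real, Complex.norm_real,
    Real.norm_of_nonneg hr, Real.norm_of_nonneg (by linarith)]
  nlinarith

/-- On the horizontal line the integrand is the Gaussian one times `exp D`, where `D` measures the
deviation of the exponent from its value for `d = 0`. -/
theorem exists_derivIntegrand_shift_eq {d b y r : ℝ} (h0 : 0 ≤ d) (h1 : d ≤ 1 / 10) (hb : |b| ≤ 1)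
    (hy : 2 ≤ y) (hr : 0 ≤ r) :
    ∃ D : ℂ, ‖D‖ ≤ d * y ^ 3 * ((1 + r) ^ 2 * (6 + r)) ∧
      ((y⁻¹ * Real.exp (y ^ 2 / 4) : ℝ) : ℂ) *
        derivIntegrand d b y (r - Complex.I * (y / 2 : ℝ)) =
      (-(1 / 2) - Complex.I * ((r / y : ℝ) : ℂ)) * Complex.exp (-(r : ℂ) ^ 2 + D) := by
  have hn : 1 ≤ ‖(r - Complex.I * (y / 2 : ℝ) : ℂ)‖ :=
    le_trans (by linarith) (le_norm_sub_I_mul_right r (y / 2))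
  have hρ := norm_sub_I_mul_half_le hr (show 1 ≤ y by linarith)
  have hz0 : (r - Complex.I * (y / 2 : ℝ) : ℂ) ≠ 0 := by
    intro h; rw [h] at hn; norm_num at hn
  obtain ⟨e, he, h⟩ := exists_mul_cpow_eq h0 h1 hb (z := r - Complex.I * (y / 2 : ℝ))
    (by simpa using hr) hz0
  have hy0 : (y : ℂ) ≠ 0 := by exact_mod_cast (show y ≠ 0 by linarith)
  refine ⟨(r - Complex.I * (y / 2 : ℝ)) ^ 2 *
    (((1 - ‖(r - Complex.I * (y / 2 : ℝ) : ℂ)‖ ^ (-d) : ℝ) : ℂ) -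
      ((‖(r - Complex.I * (y / 2 : ℝ) : ℂ)‖ ^ (-d) : ℝ) : ℂ) * e), ?_, ?_⟩
  · rw [norm_mul, norm_pow]
    set ρ := ‖(r - Complex.I * (y / 2 : ℝ) : ℂ)‖
    have hρ1 : ρ ^ (-d) ≤ 1 := Real.rpow_le_one_of_one_le_of_nonpos hn (by linarith)
    have hρ2 : 1 - d * ρ ≤ ρ ^ (-d) := by
      rw [Real.rpow_def_of_pos (by linarith)]
      have := Real.add_one_le_exp (Real.log ρ * -d)
      have := mul_le_mul_of_nonneg_right (Real.log_le_self (show 0 ≤ ρ by linarith)) h0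
      linarith
    have hbr : ‖((1 - ρ ^ (-d) : ℝ) : ℂ) - ((ρ ^ (-d) : ℝ) : ℂ) * e‖ ≤ d * ρ + 1 * (5 * d) := by
      refine (norm_sub_le _ _).trans ?_
      rw [norm_mul, Complex.norm_real, Complex.norm_real, Real.norm_of_nonneg (by linarith),
        Real.norm_of_nonneg (by positivity)]
      have : ρ ^ (-d) * ‖e‖ ≤ 1 * (5 * d) := by gcongr
      linarith
    calc ρ ^ 2 * _ ≤ (y * (1 + r)) ^ 2 * (d * (y * (1 + r)) + 1 * (5 * d)) := by
          gcongr
          exact hbr.trans (by gcongr)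
      _ = d * y ^ 2 * (1 + r) ^ 2 * (y * (1 + r) + 5) := by ring
      _ ≤ d * y ^ 2 * (1 + r) ^ 2 * (y * (6 + r)) := by
          gcongr
          linarith
      _ = _ := by ring
  · rw [derivIntegrand, h, Complex.ofReal_mul, Complex.ofReal_exp, mul_mul_mul_comm,
      ← Complex.exp_add]
    congr 1
    · push_cast
      field_simp
      linear_combination y * Complex.I_sq
    · congr 1
      push_cast
      linear_combination (y ^ 2 / 4 : ℂ) * Complex.I_sq

open MeasureTheory Filter in
/-- In the range `d y⁴ ≤ 1` the horizontal integral is asymptotic to its value for `d = 0`. -/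
theorem tendsto_integral_shift {b : ℝ} (hb : |b| ≤ 1) :
    Tendsto (fun p : ℝ × ℝ => p.2⁻¹ * Real.exp (p.2 ^ 2 / 4) * (∫ r in Set.Ioi (0 : ℝ),
      derivIntegrand p.1 b p.2 (r - Complex.I * (p.2 / 2 : ℝ))).re)
      (comap Prod.snd atTop ⊓ principal {p : ℝ × ℝ | 0 ≤ p.1 ∧ p.1 * p.2 ^ 4 ≤ 1})
      (nhds (-√Real.pi / 4)) := by
  set l := comap (Prod.snd : ℝ × ℝ → ℝ) atTop ⊓
    principal {p : ℝ × ℝ | 0 ≤ p.1 ∧ p.1 * p.2 ^ 4 ≤ 1} with hl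
  have hy : Tendsto (fun p : ℝ × ℝ => p.2) l atTop := tendsto_comap.mono_left inf_le_left
  have hmem : ∀ᶠ p : ℝ × ℝ in l, 0 ≤ p.1 ∧ p.1 * p.2 ^ 4 ≤ 1 :=
    (mem_inf_of_right (mem_principal_self _) : {p : ℝ × ℝ | 0 ≤ p.1 ∧ p.1 * p.2 ^ 4 ≤ 1} ∈ l)
  have hsmall : ∀ᶠ p : ℝ × ℝ in l, 2 ≤ p.2 ∧ 0 ≤ p.1 ∧ p.1 * p.2 ^ 4 ≤ 1 ∧ p.1 ≤ 1 / 10 := by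
    filter_upwards [hmem, hy.eventually_ge_atTop 2] with p hp h2
    refine ⟨h2, hp.1, hp.2, ?_⟩
    have : (2 : ℝ) ^ 4 ≤ p.2 ^ 4 := by gcongr
    nlinarith [hp.1, hp.2]
  have key : Tendsto (fun p : ℝ × ℝ => ∫ r in Set.Ioi (0 : ℝ),
      ((p.2⁻¹ * Real.exp (p.2 ^ 2 / 4) : ℝ) : ℂ) *
        derivIntegrand p.1 b p.2 (r - Complex.I * (p.2 / 2 : ℝ))) l
      (nhds (∫ r in Set.Ioi (0 : ℝ), ((-(1 / 2) * Real.exp (-1 * r ^ 2) : ℝ) : ℂ))) := by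
    refine tendsto_integral_filter_of_dominated_convergence
      (fun r => Real.exp 2 * ((1 + r) * Real.exp (-(1 / 6) * r))) ?_ ?_ ?_ ?_
    · filter_upwards [hsmall] with p hp
      exact ((integrableOn_derivIntegrand_shift hp.2.1 hp.2.2.2 hb hp.1).const_mul
        _).aestronglyMeasurable
    · filter_upwards [hsmall] with p hp
      refine (ae_restrict_iff' measurableSet_Ioi).2 (Eventually.of_forall fun r hr => ?_)
      obtain ⟨d, y⟩ := p
      obtain ⟨h2, h0, h4, h1⟩ := hp
      simp only at h2 h0 h4 h1 ⊢
      have hr0 : 0 ≤ r := le_of_lt hr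
      rw [norm_mul, Complex.norm_real, Real.norm_of_nonneg (by positivity)]
      have hE := norm_derivIntegrand_le h0 h1 hb (r := r) (s := y / 2) (by linarith) hr0
        (by linarith) le_rfl (le_trans (by linarith) (le_norm_sub_I_mul_right r (y / 2)))
      have hy1 : y ^ (-d) ≤ 1 := Real.rpow_le_one_of_one_le_of_nonpos (by linarith) (by linarith)
      have hdy : d * y ≤ 1 / 8 := by
        have : (2 : ℝ) ^ 3 ≤ y ^ 3 := by gcongr
        have : d * y * 2 ^ 3 ≤ d * y * y ^ 3 := by gcongr
        nlinarith
      have hy2 : 1 / 3 ≤ y ^ (-d) := by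
        rw [Real.rpow_def_of_pos (by linarith)]
        have := Real.add_one_le_exp (Real.log y * -d)
        have := mul_le_mul_of_nonneg_right (Real.log_le_self (show 0 ≤ y by linarith)) h0
        linarith
      have hdy2 : d * y ^ 2 ≤ 1 / 4 := by
        have : (2 : ℝ) ^ 2 ≤ y ^ 2 := by gcongr
        have : d * y ^ 2 * 2 ^ 2 ≤ d * y ^ 2 * y ^ 2 := by gcongr
        nlinarith
      have hexp : y ^ 2 / 4 + (-(y / 2 * y) + (1 + 5 * d) * (y / 2) ^ 2 -
          1 / 2 * y ^ (-d) * (r - 1)) ≤ 2 + -(1 / 6) * r := by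
        have := mul_le_mul_of_nonneg_right hy2 hr0
        nlinarith
      calc _ ≤ y⁻¹ * Real.exp (y ^ 2 / 4) * (y * (1 + r) * Real.exp (-(y / 2 * y) +
            (1 + 5 * d) * (y / 2) ^ 2 - 1 / 2 * y ^ (-d) * (r - 1))) := by gcongr
        _ = (1 + r) * Real.exp (y ^ 2 / 4 + (-(y / 2 * y) + (1 + 5 * d) * (y / 2) ^ 2 -
            1 / 2 * y ^ (-d) * (r - 1))) := by
          rw [Real.exp_add]
          field_simp
        _ ≤ (1 + r) * Real.exp (2 + -(1 / 6) * r) := by gcongr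
        _ = _ := by rw [Real.exp_add]; ring
    · exact (integrableOn_one_add_mul_exp (by norm_num)).const_mul _
    · refine (ae_restrict_iff' measurableSet_Ioi).2 (Eventually.of_forall fun r hr => ?_)
      have hr0 : 0 ≤ r := le_of_lt hr
      -- a choice of the deviation `D` of the exponent as a function of `(d, y)`
      have hex : ∀ p : ℝ × ℝ, ∃ D : ℂ, (2 ≤ p.2 ∧ 0 ≤ p.1 ∧ p.1 * p.2 ^ 4 ≤ 1 ∧ p.1 ≤ 1 / 10) →
          ‖D‖ ≤ p.1 * p.2 ^ 3 * ((1 + r) ^ 2 * (6 + r)) ∧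
          ((p.2⁻¹ * Real.exp (p.2 ^ 2 / 4) : ℝ) : ℂ) *
            derivIntegrand p.1 b p.2 (r - Complex.I * (p.2 / 2 : ℝ)) =
          (-(1 / 2) - Complex.I * ((r / p.2 : ℝ) : ℂ)) * Complex.exp (-(r : ℂ) ^ 2 + D) := by
        intro p
        by_cases hp : 2 ≤ p.2 ∧ 0 ≤ p.1 ∧ p.1 * p.2 ^ 4 ≤ 1 ∧ p.1 ≤ 1 / 10
        · obtain ⟨D, hD⟩ := exists_derivIntegrand_shift_eq hp.2.1 hp.2.2.2 hb hp.1 hr0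
          exact ⟨D, fun _ => hD⟩
        · exact ⟨0, fun h => absurd h hp⟩
      choose D hD using hex
      have hD0 : Tendsto D l (nhds 0) := by
        refine squeeze_zero_norm' (a := fun p : ℝ × ℝ => (1 + r) ^ 2 * (6 + r) / p.2) ?_
          (hy.const_div_atTop _)
        filter_upwards [hsmall] with p hp
        refine (hD p hp).1.trans ?_
        have hp0 : 0 < p.2 := by linarith [hp.1]
        rw [le_div_iff₀ hp0]
        have := mul_le_mul_of_nonneg_right hp.2.2.1
          (show 0 ≤ (1 + r) ^ 2 * (6 + r) by positivity)
        linarith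
      have hq : Tendsto (fun p : ℝ × ℝ => ((r / p.2 : ℝ) : ℂ)) l (nhds ((0 : ℝ) : ℂ)) :=
        (Complex.continuous_ofReal.tendsto 0).comp (hy.const_div_atTop r)
      have hprod := ((hq.const_mul Complex.I).const_sub (-(1 / 2))).mul
        ((Complex.continuous_exp.tendsto _).comp (hD0.const_add (-(r : ℂ) ^ 2)))
      have hlim : ((-(1 / 2) * Real.exp (-1 * r ^ 2) : ℝ) : ℂ) =
          (-(1 / 2) - Complex.I * ((0 : ℝ) : ℂ)) * Complex.exp (-(r : ℂ) ^ 2 + 0) := by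
        push_cast
        simp
      rw [hlim]
      refine hprod.congr' ?_
      filter_upwards [hsmall] with p hp
      exact (hD p hp).2.symm
  rw [integral_complex_ofReal, integral_const_mul, integral_gaussian_Ioi] at key
  have hre := (Complex.continuous_re.tendsto _).comp key
  have hval : (((-(1 / 2) * (√(Real.pi / 1) / 2) : ℝ) : ℂ)).re = -√Real.pi / 4 := by
    rw [Complex.ofReal_re, div_one]; ring
  rw [hval] at hre
  refine hre.congr fun p => ?_
  simp only [Function.comp_apply]
  rw [integral_const_mul, Complex.re_ofReal_mul]

open MeasureTheory in
/-- A bound on the horizontal integral that is negligible against the power law as soon as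
`d` exceeds a negative power of `y`. -/
theorem norm_integral_shift_le {d b y : ℝ} (h0 : 0 ≤ d) (h1 : d ≤ 1 / 10) (hb : |b| ≤ 1)
    (hy : 2 ≤ y) :
    ‖∫ r in Set.Ioi (0 : ℝ), derivIntegrand d b y (r - Complex.I * (y / 2 : ℝ))‖ ≤
      32 * y ^ 3 * Real.exp (-(1 / 8) * y ^ 2) := by
  have hc : -(1 / (4 * y)) < 0 := by
    have : 0 < 1 / (4 * y) := by positivity
    linarith
  have hint : ∫ r in Set.Ioi (0 : ℝ), 8 * y ^ 2 * Real.exp (-(1 / 8) * y ^ 2) *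
      Real.exp (-(1 / (4 * y)) * r) = 32 * y ^ 3 * Real.exp (-(1 / 8) * y ^ 2) := by
    rw [integral_const_mul, integral_exp_mul_Ioi hc, mul_zero, Real.exp_zero]
    field_simp
    norm_num
  rw [← hint]
  refine norm_integral_le_of_norm_le ((integrableOn_exp_mul_Ioi hc 0).const_mul _) ?_
  refine (ae_restrict_iff' measurableSet_Ioi).2 (Filter.Eventually.of_forall fun r hr => ?_)
  have hr0 : 0 ≤ r := le_of_lt hr
  refine (norm_derivIntegrand_le h0 h1 hb (r := r) (s := y / 2) (by linarith) hr0
    (by linarith) le_rfl (le_trans (by linarith) (le_norm_sub_I_mul_right r (y / 2)))).trans ?_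
  have hy1 : y ^ (-d) ≤ 1 := Real.rpow_le_one_of_one_le_of_nonpos (by linarith) (by linarith)
  have hy2 : y⁻¹ ≤ y ^ (-d) := by
    rw [← Real.rpow_neg_one]
    exact Real.rpow_le_rpow_of_exponent_le (by linarith) (by linarith)
  have hexp : -(y / 2 * y) + (1 + 5 * d) * (y / 2) ^ 2 - 1 / 2 * y ^ (-d) * (r - 1) ≤
      1 / 2 + -(1 / 8) * y ^ 2 + -(1 / (4 * y)) * r + -(1 / (4 * y)) * r := by
    have e1 := mul_le_mul_of_nonneg_right hy2 hr0
    have e2 : 1 / (4 * y) = y⁻¹ / 4 := by field_simp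
    rw [e2]
    have e3 := mul_le_mul_of_nonneg_right h1 (sq_nonneg y)
    nlinarith
  have hr1 : 1 + r ≤ 4 * y * Real.exp (1 / (4 * y) * r) := by
    have e1 := Real.add_one_le_exp (1 / (4 * y) * r)
    have e2 : 4 * y * (1 / (4 * y) * r + 1) = r + 4 * y := by field_simp
    have e3 : 4 * y * (1 / (4 * y) * r + 1) ≤ 4 * y * Real.exp (1 / (4 * y) * r) := by gcongr
    linarith
  have hhalf : Real.exp (1 / 2) ≤ 2 := by
    have := Real.exp_one_lt_d9
    have h2 : Real.exp (1 / 2) ^ 2 = Real.exp 1 := by rw [← Real.exp_nat_mul]; norm_num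
    nlinarith [Real.exp_pos (1 / 2)]
  calc _ ≤ y * (4 * y * Real.exp (1 / (4 * y) * r)) * Real.exp (1 / 2 + -(1 / 8) * y ^ 2 +
        -(1 / (4 * y)) * r + -(1 / (4 * y)) * r) := by gcongr
    _ = 4 * y ^ 2 * Real.exp (1 / 2) * Real.exp (-(1 / 8) * y ^ 2) *
        Real.exp (-(1 / (4 * y)) * r) := by
      have : Real.exp (1 / (4 * y) * r) * Real.exp (-(1 / (4 * y)) * r) = 1 := by
        rw [← Real.exp_add]; simp
      rw [Real.exp_add, Real.exp_add, Real.exp_add]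
      linear_combination (4 * y ^ 2 * Real.exp (1 / 2) * Real.exp (-(1 / 8) * y ^ 2) *
        Real.exp (-(1 / (4 * y)) * r)) * this
    _ ≤ 4 * y ^ 2 * 2 * Real.exp (-(1 / 8) * y ^ 2) * Real.exp (-(1 / (4 * y)) * r) := by gcongr
    _ = _ := by ring

/-! ### Matching the two parts with the approximant -/

open Filter in
theorem exists_pow_mul_exp_neg_sq_le (n : ℕ) {c ε : ℝ} (hc : 0 < c) (hε : 0 < ε) :
    ∃ U : ℝ, 1 ≤ U ∧ ∀ u, U ≤ u → u ^ n * Real.exp (-c * u ^ 2) ≤ ε := by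
  have h := tendsto_rpow_mul_exp_neg_mul_atTop_nhds_zero n c hc
  obtain ⟨U, hU⟩ := eventually_atTop.1 (h.eventually (eventually_le_nhds hε))
  refine ⟨max U 1, le_max_right _ _, fun u hu => ?_⟩
  have h1 : 1 ≤ u := (le_max_right _ _).trans hu
  refine le_trans ?_ (hU u ((le_max_left _ _).trans hu))
  rw [Real.rpow_natCast]
  have : -c * u ^ 2 ≤ -c * u := by nlinarith [mul_pos hc (show 0 < u by linarith)]
  gcongr

/-- The approximant at distance `y > 0` to the right of the shift. -/
noncomputable def rightApprox (d b y : ℝ) : ℝ :=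
  -(y / 2) * normalDensity y + -3 * (1 + b) * d * y ^ (d - 4)

theorem gauss_eq (y : ℝ) :
    -(y / 2) * normalDensity y = -(√Real.pi / 4 * (y * Real.exp (-(y ^ 2 / 4)))) / Real.pi := by
  have h : √Real.pi / Real.pi = 1 / √Real.pi := Real.sqrt_div_self'
  rw [normalDensity, show -(y ^ 2) / 4 = -(y ^ 2 / 4) by ring]
  linear_combination (y * Real.exp (-(y ^ 2 / 4)) / 4) * h

theorem abs_rightApprox {d b y : ℝ} (h0 : 0 ≤ d) (hb : -1 < b) (hy : 0 < y) :
    |rightApprox d b y| = √Real.pi / 4 * (y * Real.exp (-(y ^ 2 / 4))) / Real.pi +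
      3 * (1 + b) * d * y ^ (d - 4) := by
  have h1 : 0 < 1 + b := by linarith
  have hp := Real.pi_pos
  rw [rightApprox, gauss_eq, abs_of_nonpos]
  · ring
  · have : 0 ≤ √Real.pi / 4 * (y * Real.exp (-(y ^ 2 / 4))) / Real.pi := by positivity
    have : 0 ≤ 3 * (1 + b) * d * y ^ (d - 4) := by positivity
    linarith [neg_div Real.pi (√Real.pi / 4 * (y * Real.exp (-(y ^ 2 / 4))))]

theorem exists_abs_axis_sub_le {b ε : ℝ} (hb : |b| < 1) (hε : 0 < ε) :
    ∃ d₀ : ℝ, 0 < d₀ ∧ ∃ Y : ℝ, ∀ d y : ℝ, 0 ≤ d → d < d₀ → Y < y → 0 < y →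
      |1 / Real.pi * (-(Complex.I * ∫ u in (0 : ℝ)..(y / 2),
        derivIntegrand d b y ((0 : ℝ) - Complex.I * u))).re - -3 * (1 + b) * d * y ^ (d - 4)| ≤
      ε * (3 * (1 + b) * d * y ^ (d - 4)) := by
  have h1b : 0 < 1 + b := by linarith [(abs_lt.1 hb).1]
  have hp := Real.pi_pos
  have h := Metric.tendsto_nhds.1 (tendsto_integral_axisIntegrand hb.le)
    (ε * (3 * Real.pi * (1 + b))) (by positivity)
  obtain ⟨P, hP, Q, hQ, hPQ⟩ := Filter.eventually_prod_iff.1 h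
  obtain ⟨d₁, hd₁, hd⟩ := (nhdsGE_basis (0 : ℝ)).eventually_iff.1 hP
  obtain ⟨Y, hY⟩ := Filter.eventually_atTop.1 hQ
  refine ⟨min d₁ (1 / 10), lt_min hd₁ (by norm_num), Y, fun d y h0 hlt hYy hy => ?_⟩
  have h2 := hPQ (hd ⟨h0, hlt.trans_le (min_le_left _ _)⟩) (hY y hYy.le)
  rw [Real.dist_eq] at h2
  rw [re_axis_integral h0 (hlt.le.trans (min_le_right _ _)) b hy]
  simp only at h2
  set T := ∫ v in Set.Ioi (0 : ℝ), (Set.Iic (y ^ 2 / 2)).indicator (axisIntegrand b d y) v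
  have e1 : 1 / Real.pi * (-(d * y ^ (d - 4)) * T) - -3 * (1 + b) * d * y ^ (d - 4) =
      -(d * y ^ (d - 4) / Real.pi * (T - 3 * Real.pi * (1 + b))) := by
    field_simp; ring
  have hA : 0 ≤ d * y ^ (d - 4) / Real.pi := by positivity
  rw [e1, abs_neg, abs_mul, abs_of_nonneg hA]
  calc _ ≤ d * y ^ (d - 4) / Real.pi * (ε * (3 * Real.pi * (1 + b))) := by gcongr
    _ = _ := by field_simp

theorem exists_abs_shift_sub_le_gauss {b ε : ℝ} (hb : |b| < 1) (hε : 0 < ε) :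
    ∃ Y : ℝ, ∀ d y : ℝ, 0 ≤ d → Y < y → 0 < y → d * y ^ 4 ≤ 1 →
      |1 / Real.pi * (∫ r in Set.Ioi (0 : ℝ),
        derivIntegrand d b y (r - Complex.I * (y / 2 : ℝ))).re - -(y / 2) * normalDensity y| ≤
      ε * (√Real.pi / 4 * (y * Real.exp (-(y ^ 2 / 4))) / Real.pi) := by
  have hp := Real.pi_pos
  have h := Metric.tendsto_nhds.1 (tendsto_integral_shift hb.le)
    (ε * (√Real.pi / 4)) (by positivity)
  rw [Filter.eventually_inf_principal, Filter.eventually_comap] at h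
  obtain ⟨Y, hY⟩ := Filter.eventually_atTop.1 h
  refine ⟨Y, fun d y h0 hYy hy h4 => ?_⟩
  have h2 := hY y hYy.le (d, y) rfl ⟨h0, h4⟩
  rw [Real.dist_eq] at h2
  simp only at h2
  set T := (∫ r in Set.Ioi (0 : ℝ), derivIntegrand d b y (r - Complex.I * (y / 2 : ℝ))).re
  have he : Real.exp (-(y ^ 2 / 4)) * Real.exp (y ^ 2 / 4) = 1 := by rw [← Real.exp_add]; simp
  have e1 : 1 / Real.pi * T - -(y / 2) * normalDensity y =
      y * Real.exp (-(y ^ 2 / 4)) / Real.pi *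
        (y⁻¹ * Real.exp (y ^ 2 / 4) * T - -√Real.pi / 4) := by
    rw [gauss_eq]
    field_simp
    linear_combination (-4 * T) * he
  have hA : 0 ≤ y * Real.exp (-(y ^ 2 / 4)) / Real.pi := by positivity
  rw [e1, abs_mul, abs_of_nonneg hA]
  calc _ ≤ y * Real.exp (-(y ^ 2 / 4)) / Real.pi * (ε * (√Real.pi / 4)) := by gcongr
    _ = _ := by ring

/-- In the range `d y⁴ ≥ 1` the horizontal integral and the Gaussian part are both negligible
against the power law. -/
theorem exists_abs_shift_sub_le_power {b ε : ℝ} (hb : |b| < 1) (hε : 0 < ε) :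
    ∃ Y : ℝ, ∀ d y : ℝ, 0 ≤ d → d ≤ 1 / 10 → Y < y → 2 ≤ y → 1 ≤ d * y ^ 4 →
      |1 / Real.pi * (∫ r in Set.Ioi (0 : ℝ),
        derivIntegrand d b y (r - Complex.I * (y / 2 : ℝ))).re - -(y / 2) * normalDensity y| ≤
      ε * (3 * (1 + b) * d * y ^ (d - 4)) := by
  have hp := Real.pi_pos
  have h1b : 0 < 1 + b := by linarith [(abs_lt.1 hb).1]
  -- `y³ exp (-y² / 8)` is compared with `y^(-8)`; `33 = 32 + 1` accounts for the horizontal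
  -- integral and the Gaussian term
  obtain ⟨U, -, hU⟩ := exists_pow_mul_exp_neg_sq_le 11 (c := 1 / 8) (ε := ε * (3 * (1 + b)) / 33)
    (by norm_num) (by positivity)
  refine ⟨U, fun d y h0 h1 hYy hy h4 => ?_⟩
  have hy0 : 0 < y := by linarith
  have hH := (Complex.abs_re_le_norm _).trans (norm_integral_shift_le h0 h1 hb.le hy)
  set T := (∫ r in Set.Ioi (0 : ℝ), derivIntegrand d b y (r - Complex.I * (y / 2 : ℝ))).re
  have hpi3 := Real.pi_gt_three
  have a1 : |1 / Real.pi * T| ≤ |T| := by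
    rw [abs_mul, abs_of_pos (by positivity)]
    refine mul_le_of_le_one_left (abs_nonneg _) ?_
    rw [div_le_one hp]; linarith
  have a2 : |-(y / 2) * normalDensity y| ≤ y ^ 3 * Real.exp (-(1 / 8) * y ^ 2) := by
    rw [normalDensity, abs_mul, abs_neg, abs_of_pos (by positivity), abs_of_pos (by positivity)]
    have s1 : 1 ≤ √Real.pi := Real.one_le_sqrt.2 (by linarith)
    have s2 : 1 / (2 * √Real.pi) ≤ 1 := by rw [div_le_one (by positivity)]; linarith
    have s3 : y / 2 ≤ y ^ 3 := by nlinarith [sq_nonneg (y - 1)]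
    calc _ ≤ y ^ 3 * (1 * Real.exp (-(1 / 8) * y ^ 2)) := by
          gcongr
          nlinarith
      _ = _ := by ring
  have a3 := hU y hYy.le
  have a4 : 1 ≤ d * y ^ (d - 4) * y ^ 8 := by
    have : y ^ (d - 4) = y ^ d / y ^ 4 := by
      rw [Real.rpow_sub hy0]; norm_cast
    rw [this]
    have hyd : 1 ≤ y ^ d := Real.one_le_rpow (by linarith) h0
    calc (1 : ℝ) ≤ d * y ^ 4 * y ^ d := one_le_mul_of_one_le_of_one_le h4 hyd
      _ = _ := by field_simp
  have a5 : 33 * (y ^ 3 * Real.exp (-(1 / 8) * y ^ 2)) ≤ ε * (3 * (1 + b) * d * y ^ (d - 4)) := by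
    calc _ ≤ 33 * (y ^ 3 * Real.exp (-(1 / 8) * y ^ 2)) * (d * y ^ (d - 4) * y ^ 8) :=
          le_mul_of_one_le_right (by positivity) a4
      _ = 33 * (y ^ 11 * Real.exp (-(1 / 8) * y ^ 2)) * (d * y ^ (d - 4)) := by ring
      _ ≤ 33 * (ε * (3 * (1 + b)) / 33) * (d * y ^ (d - 4)) := by gcongr
      _ = _ := by ring
  refine (abs_sub _ _).trans ?_
  linarith

/-- The asymptotic formula to the right of the shift. The two parts of the approximant have the
same sign, so errors relative to either of them are errors relative to their sum. -/
theorem exists_abs_sub_rightApprox_le {b ε : ℝ} (hb : |b| < 1) (hε : 0 < ε) :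
    ∃ d₀ : ℝ, 0 < d₀ ∧ ∃ Y : ℝ, ∀ d y : ℝ, 0 ≤ d → d < d₀ → Y < y → 2 ≤ y →
      |1 / Real.pi * (∫ r in Set.Ioi (0 : ℝ), derivIntegrand d b y r).re - rightApprox d b y| ≤
        ε * |rightApprox d b y| := by
  obtain ⟨d₁, hd₁, Y₁, H₁⟩ := exists_abs_axis_sub_le hb (half_pos hε)
  obtain ⟨Y₂, H₂⟩ := exists_abs_shift_sub_le_gauss hb (half_pos hε)
  obtain ⟨Y₃, H₃⟩ := exists_abs_shift_sub_le_power hb (half_pos hε)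
  refine ⟨min d₁ (1 / 10), lt_min hd₁ (by norm_num), max Y₁ (max Y₂ Y₃),
    fun d y h0 hlt hYy hy => ?_⟩
  obtain ⟨hy1, hy23⟩ := max_lt_iff.1 hYy
  obtain ⟨hy2, hy3⟩ := max_lt_iff.1 hy23
  obtain ⟨hda, hdb⟩ := lt_min_iff.1 hlt
  have hb1 := (abs_lt.1 hb).1
  have h1b : 0 < 1 + b := by linarith
  have hp := Real.pi_pos
  rw [abs_rightApprox h0 hb1 (by linarith), integral_derivIntegrand_eq_contour h0 hdb.le hb.le hy,
    sub_eq_add_neg (∫ r in Set.Ioi (0 : ℝ), _), Complex.add_re, mul_add, rightApprox, add_sub_add_comm]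
  refine (abs_add_le _ _).trans ?_
  have hA := H₁ d y h0 hda hy1 (by linarith)
  have hg : 0 ≤ ε / 2 * (√Real.pi / 4 * (y * Real.exp (-(y ^ 2 / 4))) / Real.pi) := by positivity
  have hq : 0 ≤ ε / 2 * (3 * (1 + b) * d * y ^ (d - 4)) := by positivity
  rcases le_total (d * y ^ 4) 1 with h | h
  · have := H₂ d y h0 hy2 (by linarith) h
    linarith
  · have := H₃ d y h0 hdb.le hy3 hy h
    linarith

/-! ### Convergence of the ratio -/

theorem abs_stableShift_le {d β : ℝ} (h0 : 0 ≤ d) (h1 : d ≤ 1 / 10) (hβ : |β| ≤ 1) :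
    |stableShift (2 - d) β| ≤ 4 * d := by
  obtain ⟨ht0, ht1⟩ := tan_pi_mul_div_two_mem_Icc h0 h1
  have htan : Real.tan (Real.pi * (2 - d) / 2) = -Real.tan (Real.pi * d / 2) := by
    rw [show Real.pi * (2 - d) / 2 = Real.pi - Real.pi * d / 2 by ring, Real.tan_pi_sub]
  rw [stableShift, htan, abs_mul, abs_neg, abs_neg, abs_of_nonneg ht0]
  have : |β| * Real.tan (Real.pi * d / 2) ≤ 1 * (Real.pi * d) := by gcongr
  nlinarith [Real.pi_lt_four]

theorem derivApprox_of_pos {d β x : ℝ} (h : 0 < x - stableShift (2 - d) β) :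
    derivApprox (2 - d) β x = rightApprox d β (x - stableShift (2 - d) β) := by
  rw [derivApprox, gaussPart, powerPart, rightApprox, Real.sign_of_pos h, abs_of_pos h, mul_one,
    one_mul, sub_sub_cancel]

theorem derivApprox_of_neg {d β x : ℝ} (h : x - stableShift (2 - d) β < 0) :
    derivApprox (2 - d) β x = -rightApprox d (-β) (-(x - stableShift (2 - d) β)) := by
  rw [derivApprox, gaussPart, powerPart, rightApprox, Real.sign_of_neg h, abs_of_neg h,
    sub_sub_cancel, normalDensity, normalDensity, neg_sq]
  ring

theorem exists_forall_deriv_div_sub_lt {β : ℝ} (hβ : |β| < 1) {ε : ℝ} (hε : 0 < ε) :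
    ∃ Δ₀ : ℝ, 0 < Δ₀ ∧ ∃ x₀ : ℝ, 0 < x₀ ∧
      ∀ Δ : ℝ, 0 ≤ Δ → Δ < Δ₀ → ∀ x : ℝ, x₀ < |x| →
        DifferentiableAt ℝ (stableDensity (2 - Δ) β) x ∧
        derivApprox (2 - Δ) β x ≠ 0 ∧
        |deriv (stableDensity (2 - Δ) β) x / derivApprox (2 - Δ) β x - 1| < ε := by
  have hβ' : |-β| < 1 := by rwa [abs_neg]
  obtain ⟨d₁, hd₁, Y₁, H₁⟩ := exists_abs_sub_rightApprox_le hβ (half_pos hε)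
  obtain ⟨d₂, hd₂, Y₂, H₂⟩ := exists_abs_sub_rightApprox_le hβ' (half_pos hε)
  refine ⟨min (min d₁ d₂) (1 / 10), by positivity, max (max Y₁ Y₂) 2 + 1, by positivity,
    fun d h0 hlt x hx => ?_⟩
  obtain ⟨h12, hdc⟩ := lt_min_iff.1 hlt
  obtain ⟨hda, hdb⟩ := lt_min_iff.1 h12
  have hder := hasDerivAt_stableDensity_halfLine (show d < 2 by linarith) β x
  have hshift := abs_stableShift_le h0 hdc.le hβ.le
  -- the shift is at most `1`, so the distance from it is still large
  have hdist : max (max Y₁ Y₂) 2 < |x - stableShift (2 - d) β| := by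
    have := abs_sub_abs_le_abs_sub x (stableShift (2 - d) β)
    linarith
  refine ⟨hder.differentiableAt, ?_⟩
  rw [hder.deriv]
  have ratio : ∀ {J G : ℝ}, G ≠ 0 → |J - G| ≤ ε / 2 * |G| → |J / G - 1| < ε := by
    intro J G hG h
    rw [div_sub_one hG, abs_div, div_lt_iff₀ (abs_pos.2 hG)]
    have := abs_pos.2 hG
    nlinarith
  have hne : ∀ {b y : ℝ}, |b| < 1 → 2 < y → rightApprox d b y ≠ 0 := by
    intro b y hb hy
    have hb1 := (abs_lt.1 hb).1
    have hb2 : 0 < 1 + b := by linarith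
    have hy0 : 0 < y := by linarith
    rw [← abs_pos, abs_rightApprox h0 hb1 hy0]
    positivity
  rcases le_total 0 (x - stableShift (2 - d) β) with hs | hs
  · rw [abs_of_nonneg hs] at hdist
    obtain ⟨hY12, hy⟩ := max_lt_iff.1 hdist
    obtain ⟨hY1, -⟩ := max_lt_iff.1 hY12
    rw [derivApprox_of_pos (by linarith)]
    exact ⟨hne hβ hy, ratio (hne hβ hy) (H₁ _ _ h0 hda hY1 hy.le)⟩
  · rw [abs_of_nonpos hs] at hdist
    obtain ⟨hY12, hy⟩ := max_lt_iff.1 hdist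
    obtain ⟨-, hY2⟩ := max_lt_iff.1 hY12
    have hrefl := re_integral_derivIntegrand_neg (show d < 2 by linarith) β
      (-(x - stableShift (2 - d) β))
    rw [neg_neg] at hrefl
    rw [derivApprox_of_neg (by linarith), hrefl, mul_neg, neg_div_neg_eq]
    exact ⟨neg_ne_zero.2 (hne hβ' hy), ratio (hne hβ' hy) (H₂ _ _ h0 hdb hY2 hy.le)⟩

/-! ### The ranges of dominance -/

theorem abs_gaussPart (α β x : ℝ) :
    |gaussPart α β x| = |x - stableShift α β| / (4 * √Real.pi) *
      Real.exp (-(|x - stableShift α β| ^ 2 / 4)) := by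
  have : 0 < √Real.pi := Real.sqrt_pos.2 Real.pi_pos
  rw [gaussPart, normalDensity, abs_mul, abs_mul, abs_neg, abs_div, Real.abs_exp, sq_abs,
    abs_of_pos (show 0 < 1 / (2 * √Real.pi) by positivity), neg_div, abs_two]
  ring

theorem abs_powerPart {d β x : ℝ} (h0 : 0 ≤ d) (hβ : |β| < 1)
    (hx : x - stableShift (2 - d) β ≠ 0) :
    |powerPart (2 - d) β x| = 3 * (1 + β * Real.sign (x - stableShift (2 - d) β)) * d *
        |x - stableShift (2 - d) β| ^ (d - 4) ∧
      1 - |β| ≤ 1 + β * Real.sign (x - stableShift (2 - d) β) ∧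
      1 + β * Real.sign (x - stableShift (2 - d) β) ≤ 2 := by
  have h1 : |Real.sign (x - stableShift (2 - d) β)| = 1 := by
    rcases hx.lt_or_gt with h | h
    · rw [Real.sign_of_neg h]; simp
    · rw [Real.sign_of_pos h]; simp
  have h2 : |β * Real.sign (x - stableShift (2 - d) β)| = |β| := by rw [abs_mul, h1, mul_one]
  have h3 := abs_le.1 h2.le
  have h4 : 0 < 1 + β * Real.sign (x - stableShift (2 - d) β) := by linarith
  refine ⟨?_, by linarith, by linarith⟩
  rw [powerPart, abs_mul, abs_mul, abs_mul, abs_mul, h1, abs_of_pos h4, sub_sub_cancel,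
    abs_of_nonneg h0, abs_of_nonneg (Real.rpow_nonneg (abs_nonneg _) _)]
  norm_num

theorem rpow_eq_exp_neg_log_inv {Δ : ℝ} (hΔ : 0 < Δ) (s : ℝ) :
    Δ ^ s = Real.exp (-(s * Real.log (1 / Δ))) := by
  rw [Real.rpow_def_of_pos hΔ, one_div, Real.log_inv]
  congr 1
  ring

/-- Below `(2 - δ) √(log (1/Δ))` the Gaussian factor is at least `Δ^((1 - δ/2)²)`, and
`(1 - δ/2)² < 1 - δ/2`. -/
theorem exists_power_le_gauss {δ m η : ℝ} (hδ : 0 < δ) (hm : 0 < m) (hη : 0 < η) :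
    ∃ Δ₁ : ℝ, 0 < Δ₁ ∧ ∀ Δ u : ℝ, 0 < Δ → Δ < Δ₁ → m ≤ u →
      u ≤ (2 - δ) * (Real.log (1 / Δ)) ^ (1 / 2 : ℝ) →
        6 * Δ * u ^ (Δ - 4) ≤ η * Δ ^ (δ / 2) * (u / (4 * √Real.pi) *
          Real.exp (-(u ^ 2 / 4))) := by
  have hpi : 0 < √Real.pi := Real.sqrt_pos.2 Real.pi_pos
  rcases le_or_gt 2 δ with h2 | h2
  · -- the range is empty
    refine ⟨1, one_pos, fun Δ u h0 h1 hmu hu => ?_⟩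
    have hlog : 0 ≤ Real.log (1 / Δ) := Real.log_nonneg (by rw [le_div_iff₀ h0]; linarith)
    have := mul_nonneg (show 0 ≤ δ - 2 by linarith)
      (Real.rpow_nonneg hlog (1 / 2 : ℝ))
    linarith
  set κ := (1 - δ / 2) * (δ / 2) with hκ
  have hκ0 : 0 < κ := mul_pos (by linarith) (by linarith)
  set C := 24 * √Real.pi * (1 + m⁻¹ ^ 5) with hC
  have hC0 : 0 < C := by positivity
  have hlim : Filter.Tendsto (fun Δ : ℝ => C * Δ ^ κ) (nhds 0) (nhds (C * 0 ^ κ)) :=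
    ((Real.continuousAt_rpow_const 0 κ (Or.inr hκ0.le)).tendsto).const_mul C
  rw [Real.zero_rpow hκ0.ne', mul_zero] at hlim
  obtain ⟨r, hr, hball⟩ := Metric.eventually_nhds_iff.1 (hlim.eventually (eventually_le_nhds hη))
  refine ⟨min r 1, by positivity, fun Δ u h0 h1 hmu hu => ?_⟩
  obtain ⟨h1r, h11⟩ := lt_min_iff.1 h1
  have hsmall : C * Δ ^ κ ≤ η := hball (by rwa [Real.dist_eq, sub_zero, abs_of_pos h0])
  have hlog : 0 ≤ Real.log (1 / Δ) := Real.log_nonneg (by rw [le_div_iff₀ h0]; linarith)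
  have hu0 : 0 < u := by linarith
  have hsq : u ^ 2 ≤ (2 - δ) ^ 2 * Real.log (1 / Δ) := by
    calc u ^ 2 ≤ ((2 - δ) * (Real.log (1 / Δ)) ^ (1 / 2 : ℝ)) ^ 2 := by gcongr
      _ = _ := by rw [mul_pow, ← Real.sqrt_eq_rpow, Real.sq_sqrt hlog]
  have hgauss : Δ ≤ Δ ^ (δ / 2) * Δ ^ κ * Real.exp (-(u ^ 2 / 4)) := by
    conv_lhs => rw [← Real.rpow_one Δ]
    rw [rpow_eq_exp_neg_log_inv h0, rpow_eq_exp_neg_log_inv h0, rpow_eq_exp_neg_log_inv h0,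
      ← Real.exp_add, ← Real.exp_add]
    refine Real.exp_le_exp.2 ?_
    rw [hκ]
    nlinarith
  have hpow : u ^ (Δ - 4) ≤ (1 + m⁻¹ ^ 5) * u := by
    rcases le_total 1 u with h | h
    · have e1 : u ^ (Δ - 4) ≤ 1 := Real.rpow_le_one_of_one_le_of_nonpos h (by linarith)
      have e2 : 0 ≤ m⁻¹ ^ 5 * u := by positivity
      linarith
    · have e1 : u ^ (Δ - 4) ≤ u ^ (-4 : ℝ) :=
        Real.rpow_le_rpow_of_exponent_ge hu0 h (by linarith)
      have e2 : u ^ (-4 : ℝ) = u⁻¹ ^ 5 * u := by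
        rw [Real.rpow_neg hu0.le]
        norm_cast
        field_simp
      have e3 : u⁻¹ ^ 5 ≤ m⁻¹ ^ 5 := by gcongr
      have e4 : u⁻¹ ^ 5 * u ≤ m⁻¹ ^ 5 * u := by gcongr
      linarith
  calc 6 * Δ * u ^ (Δ - 4) ≤ 6 * (Δ ^ (δ / 2) * Δ ^ κ * Real.exp (-(u ^ 2 / 4))) *
        ((1 + m⁻¹ ^ 5) * u) := by gcongr
    _ = (C * Δ ^ κ) * Δ ^ (δ / 2) * (u / (4 * √Real.pi) * Real.exp (-(u ^ 2 / 4))) := by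
        rw [hC]; field_simp; ring
    _ ≤ _ := by gcongr

/-- Above `(2 + δ) √(log (1/Δ))` the Gaussian factor is at most `Δ^((1 + δ/2)²)`; the fraction
`(1 + δ/2)⁻¹` of its exponent gives `Δ^(1 + δ/2)`, and the remainder absorbs powers of `u`. -/
theorem exists_gauss_le_power {δ c η : ℝ} (hδ : 0 < δ) (hc : 0 < c) (hη : 0 < η) :
    ∃ Δ₁ : ℝ, 0 < Δ₁ ∧ ∀ Δ u : ℝ, 0 < Δ → Δ < Δ₁ → 0 ≤ u →
      (2 + δ) * (Real.log (1 / Δ)) ^ (1 / 2 : ℝ) ≤ u →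
        u / (4 * √Real.pi) * Real.exp (-(u ^ 2 / 4)) ≤
          η * Δ ^ (δ / 2) * (3 * c * Δ * u ^ (Δ - 4)) := by
  have hpi : 1 ≤ √Real.pi := Real.one_le_sqrt.2 (by linarith [Real.pi_gt_three])
  set s := (1 + δ / 2)⁻¹ with hs
  have hs0 : 0 < s := by positivity
  have hs1 : s < 1 := inv_lt_one_of_one_lt₀ (by linarith)
  have hsδ : s * (1 + δ / 2) = 1 := inv_mul_cancel₀ (by positivity)
  obtain ⟨U, hU1, hU⟩ := exists_pow_mul_exp_neg_sq_le 5 (c := (1 - s) / 4) (ε := η * (3 * c))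
    (by linarith) (by positivity)
  refine ⟨Real.exp (-U ^ 2), Real.exp_pos _, fun Δ u h0 h1 hu0 hu => ?_⟩
  have hL : U ^ 2 ≤ Real.log (1 / Δ) := by
    rw [one_div, Real.log_inv]
    have := Real.log_lt_log h0 h1
    rw [Real.log_exp] at this
    linarith
  have hlog : 0 ≤ Real.log (1 / Δ) := (sq_nonneg U).trans hL
  rw [← Real.sqrt_eq_rpow] at hu
  have hUu : U ≤ u := by
    have e1 : U ≤ √(Real.log (1 / Δ)) := Real.le_sqrt_of_sq_le hL
    have e2 := Real.sqrt_nonneg (Real.log (1 / Δ))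
    nlinarith
  have hu1 : 1 ≤ u := hU1.trans hUu
  have hsq : (2 + δ) ^ 2 * Real.log (1 / Δ) ≤ u ^ 2 := by
    calc _ = ((2 + δ) * √(Real.log (1 / Δ))) ^ 2 := by rw [mul_pow, Real.sq_sqrt hlog]
      _ ≤ _ := by gcongr
  have hgauss : Real.exp (-(u ^ 2 / 4)) ≤
      Real.exp (-((1 - s) / 4) * u ^ 2) * (Δ ^ (δ / 2) * Δ) := by
    have e0 : Δ ^ (δ / 2) * Δ = Real.exp (-((1 + δ / 2) * Real.log (1 / Δ))) := by
      rw [← rpow_eq_exp_neg_log_inv h0, add_comm, Real.rpow_add h0, Real.rpow_one]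
    rw [e0, ← Real.exp_add]
    refine Real.exp_le_exp.2 ?_
    have e1 : s / 4 * ((2 + δ) ^ 2 * Real.log (1 / Δ)) ≤ s / 4 * u ^ 2 := by gcongr
    have e2 : s / 4 * ((2 + δ) ^ 2 * Real.log (1 / Δ)) =
        (s * (1 + δ / 2)) * ((1 + δ / 2) * Real.log (1 / Δ)) := by ring
    rw [e2, hsδ] at e1
    linarith
  have hpow : 1 ≤ u ^ (Δ - 4) * u ^ 4 := by
    have : u ^ (Δ - 4) * u ^ 4 = u ^ Δ := by
      rw [← Real.rpow_natCast, ← Real.rpow_add (by linarith)]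
      norm_num
    rw [this]
    exact Real.one_le_rpow hu1 h0.le
  have hdiv : u / (4 * √Real.pi) ≤ u := div_le_self hu0 (by linarith)
  calc u / (4 * √Real.pi) * Real.exp (-(u ^ 2 / 4)) ≤
        u * (Real.exp (-((1 - s) / 4) * u ^ 2) * (Δ ^ (δ / 2) * Δ)) := by gcongr
    _ ≤ u * (Real.exp (-((1 - s) / 4) * u ^ 2) * (Δ ^ (δ / 2) * Δ)) * (u ^ (Δ - 4) * u ^ 4) :=
        le_mul_of_one_le_right (by positivity) hpow
    _ = (u ^ 5 * Real.exp (-((1 - s) / 4) * u ^ 2)) * (Δ ^ (δ / 2) * Δ * u ^ (Δ - 4)) := by ring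
    _ ≤ (η * (3 * c)) * (Δ ^ (δ / 2) * Δ * u ^ (Δ - 4)) := by
        exact mul_le_mul_of_nonneg_right (hU u hUu) (by positivity)
    _ = _ := by ring

theorem exists_forall_dominance {β : ℝ} (hβ : |β| < 1) {δ x₀ η : ℝ} (hδ : 0 < δ) (hx₀ : 0 < x₀)
    (hη : 0 < η) :
    ∃ Δ₁ : ℝ, 0 < Δ₁ ∧ ∀ Δ : ℝ, 0 < Δ → Δ < Δ₁ → ∀ x : ℝ, x₀ < |x| →
      (|x - stableShift (2 - Δ) β| ≤ (2 - δ) * (Real.log (1 / Δ)) ^ (1 / 2 : ℝ) →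
        |derivApprox (2 - Δ) β x - gaussPart (2 - Δ) β x|
          ≤ η * Δ ^ (δ / 2) * |gaussPart (2 - Δ) β x|) ∧
      ((2 + δ) * (Real.log (1 / Δ)) ^ (1 / 2 : ℝ) ≤ |x - stableShift (2 - Δ) β| →
        |derivApprox (2 - Δ) β x - powerPart (2 - Δ) β x|
          ≤ η * Δ ^ (δ / 2) * |powerPart (2 - Δ) β x|) := by
  obtain ⟨Δ₁, h₁, H₁⟩ := exists_power_le_gauss hδ (half_pos hx₀) hη
  obtain ⟨Δ₂, h₂, H₂⟩ := exists_gauss_le_power hδ (sub_pos.2 hβ) hη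
  refine ⟨min (min Δ₁ Δ₂) (min (1 / 10) (x₀ / 8)), by positivity, fun Δ h0 hlt x hx => ?_⟩
  obtain ⟨h12, h34⟩ := lt_min_iff.1 hlt
  obtain ⟨ha, hb⟩ := lt_min_iff.1 h12
  obtain ⟨hc, hd⟩ := lt_min_iff.1 h34
  have hdist : x₀ / 2 ≤ |x - stableShift (2 - Δ) β| := by
    have e1 := abs_sub_abs_le_abs_sub x (stableShift (2 - Δ) β)
    have e2 := abs_stableShift_le h0.le hc.le hβ.le
    linarith
  have hne : x - stableShift (2 - Δ) β ≠ 0 := abs_pos.1 (by linarith)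
  obtain ⟨hpow, hlow, hupp⟩ := abs_powerPart h0.le hβ hne
  constructor
  · intro hu
    rw [derivApprox, add_sub_cancel_left, hpow, abs_gaussPart]
    refine le_trans ?_ (H₁ Δ _ h0 ha hdist hu)
    have : 3 * (1 + β * Real.sign (x - stableShift (2 - Δ) β)) ≤ 6 := by linarith
    gcongr
  · intro hu
    rw [derivApprox, add_sub_cancel_right, hpow, abs_gaussPart]
    refine (H₂ Δ _ h0 hb (abs_nonneg _) hu).trans ?_
    gcongr

theorem mainTheorem3 (β : ℝ) (hβ₁ : -1 < β) (hβ₂ : β < 1) :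
    -- `f'/g' → 1` as `Δ → 0`, `|x| → ∞`
    (∀ ε : ℝ, 0 < ε → ∃ Δ₀ : ℝ, 0 < Δ₀ ∧ ∃ x₀ : ℝ, 0 < x₀ ∧
      ∀ Δ : ℝ, 0 ≤ Δ → Δ < Δ₀ → ∀ x : ℝ, x₀ < |x| →
        DifferentiableAt ℝ (stableDensity (2 - Δ) β) x ∧
        derivApprox (2 - Δ) β x ≠ 0 ∧
        |deriv (stableDensity (2 - Δ) β) x / derivApprox (2 - Δ) β x - 1| < ε) ∧
    -- dominance of the Gaussian part and of the power part, uniformly in `|x| > x₀`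
    (∀ δ : ℝ, 0 < δ → ∀ x₀ : ℝ, 0 < x₀ → ∀ η : ℝ, 0 < η →
      ∃ Δ₁ : ℝ, 0 < Δ₁ ∧ ∀ Δ : ℝ, 0 < Δ → Δ < Δ₁ → ∀ x : ℝ, x₀ < |x| →
        (|x - stableShift (2 - Δ) β| ≤ (2 - δ) * (Real.log (1 / Δ)) ^ (1 / 2 : ℝ) →
          |derivApprox (2 - Δ) β x - gaussPart (2 - Δ) β x|
            ≤ η * Δ ^ (δ / 2) * |gaussPart (2 - Δ) β x|) ∧
        ((2 + δ) * (Real.log (1 / Δ)) ^ (1 / 2 : ℝ) ≤ |x - stableShift (2 - Δ) β| →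
          |derivApprox (2 - Δ) β x - powerPart (2 - Δ) β x|
            ≤ η * Δ ^ (δ / 2) * |powerPart (2 - Δ) β x|)) :=
  have hβ : |β| < 1 := abs_lt.2 ⟨hβ₁, hβ₂⟩
  ⟨fun _ hε => exists_forall_deriv_div_sub_lt hβ hε,
    fun _ hδ _ hx₀ _ hη => exists_forall_dominance hβ hδ hx₀ hη⟩
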